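/- Let $f\in\mathbb{C}[X_0,X_1,X_2]$ be a reduced (square-free) homogeneous polynomial of degree $d\ge 4$, let $X=V(f)\subset\mathbb{P}^2$ be the plane curve it defines, and put $f_i=\partial f/\partial X_i$ for $i=0,1,2$. Let $T\langle X\rangle\subset T_{\mathbb{P}^2}$ be the sheaf of logarithmic vector fields along $X$, that is, the sheaf of those $\mathbb{C}$-derivations of $\mathcal{O}_{\mathbb{P}^2}$ that map the ideal sheaf of $X$ into itself; equivalently, the kernel of the map $\eta:T_{\mathbb{P}^2}\to\mathcal{O}_X(d)$, $\sum_i A_i\,\partial/\partial X_i\mapsto\sum_i A_i f_i$. Then $T\langle X\rangle$ is stable if and only if $(f_0,f_1,f_2)$ has no syzygy of degree $\lfloor (d-1)/2\rfloor$, i.e. there is no triple $(a_0,a_1,a_2)\neq(0,0,0)$ of homogeneous polynomials of degree $\lfloor (d-1)/2\rfloor$ (the zero polynomial being allowed as an entry) with $a_0f_0+a_1f_1+a_2f_2=0$. In particular, $T\langle X\rangle$ is stable if $X$ is nonsingular. Here stability is slope stability (Mumford–Takemoto): every coherent subsheaf $F\subset T\langle X\rangle$ with $0<\operatorname{rk}F<\operatorname{rk}T\langle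 X\rangle$ satisfies $c_1(F)/\operatorname{rk}F<c_1(T\langle X\rangle)/\operatorname{rk}T\langle X\rangle$. -/

import Mathlib

open CategoryTheory AlgebraicGeometry TopologicalSpace Opposite

noncomputable section

namespace PlaneCurve

/-! ### The projective plane -/

/-- The homogeneous coordinate ring `ℂ[X₀, X₁, X₂]`. -/
abbrev CoordRing : Type := MvPolynomial (Fin 3) ℂ

/-- The standard grading of the homogeneous coordinate ring. -/
abbrev grading : ℕ → Submodule ℂ CoordRing := MvPolynomial.homogeneousSubmodule (Fin 3) ℂ

instance : GradedAlgebra grading := MvPolynomial.gradedAlgebra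

/-- The projective plane over `ℂ`, as a scheme. -/
abbrev P2 : Scheme.{0} := Proj grading

/-- The homogeneous prime ideal of `ℂ[X₀, X₁, X₂]` corresponding to a point of the plane. -/
abbrev pointIdeal (x : P2) : Ideal CoordRing :=
  HomogeneousIdeal.toIdeal (ProjectiveSpectrum.asHomogeneousIdeal x)

instance (x : P2) : (pointIdeal x).IsPrime := ProjectiveSpectrum.isPrime x

/-- The local ring of the plane at `x`: fractions `a / b` of homogeneous polynomials of the same
degree with `b` not in the prime ideal of `x`.  In Mathlib, the sections of the structure sheaf of
`Proj` over an open set `U` are the functions on `U` with values in these rings that are locally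
given by a single such fraction; `s.1 x` is the value (germ) of the section `s` at `x`. -/
abbrev LocalRing (x : P2) : Type := HomogeneousLocalization.AtPrime grading (pointIdeal x)

instance (x : P2) : Algebra ℂ (LocalRing x) where
  algebraMap := (HomogeneousLocalization.fromZeroRingHom grading (pointIdeal x).primeCompl).comp
    (algebraMap ℂ (grading 0))
  commutes' _ _ := mul_comm _ _
  smul_def' c s := by
    apply HomogeneousLocalization.val_injective
    rw [HomogeneousLocalization.val_smul, HomogeneousLocalization.val_mul]
    rw [Algebra.smul_def]
    rfl

/-- Constants as regular functions on an open set. -/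
def const (U : P2.Opens) : ℂ →+* Γ(P2, U) where
  toFun c := ⟨fun x : U => algebraMap ℂ (LocalRing x.1) c, fun x =>
    ⟨U, x.2, 𝟙 U, 0, algebraMap ℂ (grading 0) c, ⟨1, SetLike.GradedOne.one_mem⟩,
      fun y => (Ideal.ne_top_iff_one _).mp (ProjectiveSpectrum.isPrime y.1).ne_top,
      fun _ => rfl⟩⟩
  map_one' := Subtype.ext (funext fun x : U => map_one (algebraMap ℂ (LocalRing x.1)))
  map_mul' a b := Subtype.ext (funext fun x : U => map_mul (algebraMap ℂ (LocalRing x.1)) a b)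
  map_zero' := Subtype.ext (funext fun x : U => map_zero (algebraMap ℂ (LocalRing x.1)))
  map_add' a b := Subtype.ext (funext fun x : U => map_add (algebraMap ℂ (LocalRing x.1)) a b)

/-- The standard affine open set `Xᵢ ≠ 0`. -/
abbrev chart (i : Fin 3) : P2.Opens := Proj.basicOpen grading (MvPolynomial.X i)

/-- The regular function `Xⱼ / Xᵢ` on the open set `Xᵢ ≠ 0`. -/
def ratio (i j : Fin 3) : Γ(P2, chart i) :=
  ⟨fun x => .mk ⟨1, ⟨MvPolynomial.X j, MvPolynomial.isHomogeneous_X ℂ j⟩,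
      ⟨MvPolynomial.X i, MvPolynomial.isHomogeneous_X ℂ i⟩, x.2⟩,
    fun x => ⟨chart i, x.2, 𝟙 _, 1, ⟨MvPolynomial.X j, MvPolynomial.isHomogeneous_X ℂ j⟩,
      ⟨MvPolynomial.X i, MvPolynomial.isHomogeneous_X ℂ i⟩, fun y => y.2, fun _ => rfl⟩⟩

/-! ### The sheaf of logarithmic vector fields -/

/-- The stalk at `x` of the ideal sheaf of the curve `f = 0`: the elements of the local ring that
are multiples of `f` in the localization of the coordinate ring. -/
def curveIdeal (f : CoordRing) (x : P2) : Ideal (LocalRing x) :=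
  ((Ideal.span {f}).map
      (algebraMap CoordRing (Localization (pointIdeal x).primeCompl))).comap
    (algebraMap (LocalRing x) (Localization (pointIdeal x).primeCompl))

/-- A family of `ℂ`-derivations of the local rings at the points of `U` is a logarithmic vector
field on `U` along the curve `f = 0` if it maps regular functions on open subsets of `U` to regular
functions (that is, it is a derivation of the structure sheaf of `U`), and if it preserves the ideal
sheaf of the curve. -/
structure IsLogField (f : CoordRing) (U : P2.Opens)
    (D : ∀ x : U, Derivation ℂ (LocalRing x.1) (LocalRing x.1)) : Prop where
  regular : ∀ (V : P2.Opens) (hV : V ≤ U) (s : Γ(P2, V)),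
    ∃ t : Γ(P2, V), ∀ x : V, t.1 x = D ⟨x.1, hV x.2⟩ (s.1 x)
  preserves : ∀ (x : U), ∀ s ∈ curveIdeal f x.1, D x s ∈ curveIdeal f x.1

/-- The additive group of logarithmic vector fields on `U` along `f = 0`. -/
def logFields (f : CoordRing) (U : P2.Opens) :
    AddSubgroup (∀ x : U, Derivation ℂ (LocalRing x.1) (LocalRing x.1)) where
  carrier := {D | IsLogField f U D}
  zero_mem' := ⟨fun V _ _ => ⟨0, fun _ => rfl⟩, fun _ _ _ => Ideal.zero_mem _⟩
  add_mem' {D E} hD hE :=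
    ⟨fun V hV s => by
      obtain ⟨t, ht⟩ := hD.regular V hV s
      obtain ⟨u, hu⟩ := hE.regular V hV s
      exact ⟨t + u, fun x => (congrArg₂ (· + ·) (ht x) (hu x) :)⟩,
    fun x s hs => Ideal.add_mem _ (hD.preserves x s hs) (hE.preserves x s hs)⟩
  neg_mem' {D} hD :=
    ⟨fun V hV s => by
      obtain ⟨t, ht⟩ := hD.regular V hV s
      exact ⟨-t, fun x => (congrArg (- ·) (ht x) :)⟩,
    fun x s hs => neg_mem (hD.preserves x s hs)⟩

instance (f : CoordRing) (U : P2.Opens) : SMul Γ(P2, U) (logFields f U) where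
  smul r D := ⟨fun x => (r.1 x : LocalRing x.1) • D.1 x,
    fun V hV s => by
      obtain ⟨t, ht⟩ := D.2.regular V hV s
      exact ⟨P2.presheaf.map (homOfLE hV).op r * t,
        fun x => (congrArg ((r.1 ⟨x.1, hV x.2⟩ : LocalRing x.1) * ·) (ht x) :)⟩,
    fun x s hs => Ideal.mul_mem_left _ _ (D.2.preserves x s hs)⟩

instance (f : CoordRing) (U : P2.Opens) : Module Γ(P2, U) (logFields f U) where
  one_smul D := Subtype.ext (funext fun x => one_smul (LocalRing x.1) (D.1 x))
  mul_smul r s D :=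
    Subtype.ext (funext fun x => mul_smul (r.1 x : LocalRing x.1) (s.1 x : LocalRing x.1) (D.1 x))
  smul_zero r := Subtype.ext (funext fun x => smul_zero (r.1 x : LocalRing x.1))
  smul_add r D E :=
    Subtype.ext (funext fun x => smul_add (r.1 x : LocalRing x.1) (D.1 x) (E.1 x))
  add_smul r s D :=
    Subtype.ext (funext fun x => add_smul (r.1 x : LocalRing x.1) (s.1 x : LocalRing x.1) (D.1 x))
  zero_smul D := Subtype.ext (funext fun x => zero_smul (LocalRing x.1) (D.1 x))

/-- Restriction of logarithmic vector fields. -/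
def logRestrict (f : CoordRing) {U V : P2.Opens} (h : V ≤ U) : logFields f U →+ logFields f V where
  toFun D := ⟨fun x => D.1 ⟨x.1, h x.2⟩,
    fun W hW s => D.2.regular W (hW.trans h) s, fun x => D.2.preserves ⟨x.1, h x.2⟩⟩
  map_zero' := rfl
  map_add' _ _ := rfl

/-- The presheaf of abelian groups of logarithmic vector fields. -/
def logPresheaf (f : CoordRing) : TopCat.Presheaf Ab.{0} P2 where
  obj U := AddCommGrpCat.of (logFields f U.unop)
  map i := AddCommGrpCat.ofHom (logRestrict f i.unop.le)

theorem logPresheaf_isSheaf (f : CoordRing) : (logPresheaf f).IsSheaf := by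
  rw [TopCat.Presheaf.isSheaf_iff_isSheafUniqueGluing]
  intro ι U sf hsf
  have hmem : ∀ x : (iSup U : P2.Opens), ∃ i, x.1 ∈ U i := fun x => Opens.mem_iSup.mp x.2
  choose k hk using hmem
  let σ : ∀ i, logFields f (U i) := sf
  have hσ : ∀ (i j : ι) (x : P2) (hi : x ∈ U i) (hj : x ∈ U j),
      (σ i).1 ⟨x, hi⟩ = (σ j).1 ⟨x, hj⟩ := by
    intro i j x hi hj
    have h : logRestrict f (inf_le_left : U i ⊓ U j ≤ U i) (σ i)
        = logRestrict f (inf_le_right : U i ⊓ U j ≤ U j) (σ j) := hsf i j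
    exact congrArg (fun E : logFields f (U i ⊓ U j) => E.1 ⟨x, hi, hj⟩) h
  let D : ∀ x : (iSup U : P2.Opens), Derivation ℂ (LocalRing x.1) (LocalRing x.1) :=
    fun x => (σ (k x)).1 ⟨x.1, hk x⟩
  have hD : IsLogField f (iSup U) D := by
    refine ⟨fun V hV s => ?_, fun x => (σ (k x)).2.preserves ⟨x.1, hk x⟩⟩
    refine ⟨⟨fun x => D ⟨x.1, hV x.2⟩ (s.1 x), ?_⟩, fun x => rfl⟩
    refine (ProjectiveSpectrum.StructureSheaf.isLocallyFraction grading).locality _ fun x => ?_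
    let i := k ⟨x.1, hV x.2⟩
    have hi : x.1 ∈ U i := hk ⟨x.1, hV x.2⟩
    obtain ⟨t, ht⟩ := (σ i).2.regular (V ⊓ U i) inf_le_right
      (P2.presheaf.map (homOfLE (inf_le_left : V ⊓ U i ≤ V)).op s)
    refine ⟨V ⊓ U i, ⟨x.2, hi⟩, homOfLE inf_le_left, ?_⟩
    have h : (fun y : (V ⊓ U i : P2.Opens) => D ⟨y.1, hV y.2.1⟩ (s.1 ⟨y.1, y.2.1⟩)) = t.1 := by
      funext y
      refine Eq.trans ?_ (ht y).symm
      exact congrArg (fun E : Derivation ℂ (LocalRing y.1) (LocalRing y.1) =>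
        E (s.1 ⟨y.1, y.2.1⟩)) (hσ _ i y.1 _ y.2.2)
    exact h ▸ t.2
  refine ⟨(⟨D, hD⟩ : logFields f (iSup U)), fun i => ?_, fun E hE => ?_⟩
  · exact Subtype.ext (funext fun x => hσ _ i x.1 _ x.2)
  · refine Subtype.ext (funext fun x => ?_)
    have h : logRestrict f (le_iSup U (k x)) E = σ (k x) := hE (k x)
    exact congrArg (fun E : logFields f (U (k x)) => E.1 ⟨x.1, hk x⟩) h

instance (f : CoordRing) (U : P2.Opensᵒᵖ) :
    Module (P2.ringCatSheaf.obj.obj U) ((logPresheaf f).obj U) :=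
  inferInstanceAs (Module Γ(P2, U.unop) (logFields f U.unop))

/-- The sheaf `T⟨X⟩` of logarithmic vector fields along the plane curve `X` with equation `f = 0`,
as a sheaf of modules over the structure sheaf of the plane. -/
def logTangentSheaf (f : CoordRing) : P2.Modules :=
  SheafOfModules.mk (R := P2.ringCatSheaf)
    (PresheafOfModules.ofPresheaf (R := P2.ringCatSheaf.obj) (logPresheaf f)
      (fun _ _ _ _ _ => rfl))
    (logPresheaf_isSheaf f)

/-- The sections of `T⟨X⟩` over `U` are the logarithmic vector fields on `U`. -/
theorem logTangentSheaf_sections (f : CoordRing) (U : P2.Opens) :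
    (Γ(logTangentSheaf f, U) : Type) = logFields f U := rfl

/-! ### Coherent subsheaves, Hilbert polynomials, and slope stability -/

/-- Restriction of sections of a sheaf of modules. -/
abbrev res (E : P2.Modules) {U V : P2.Opens} (h : V ≤ U) (s : Γ(E, U)) : Γ(E, V) :=
  E.presheaf.map (homOfLE h).op s

/-- Sections of a sheaf of modules form complex vector spaces, through the constant functions. -/
instance (E : P2.Modules) (U : P2.Opens) : Module ℂ Γ(E, U) := Module.compHom _ (const U)

theorem res_const_smul (E : P2.Modules) {U V : P2.Opens} (h : V ≤ U) (c : ℂ) (s : Γ(E, U)) :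
    res E h (c • s) = c • res E h s :=
  E.map_smul (homOfLE h) (const U c) s

/-- A subsheaf of modules of a sheaf of modules. -/
structure Subsheaf (E : P2.Modules) where
  sections : ∀ U : P2.Opens, Submodule Γ(P2, U) Γ(E, U)
  res_mem : ∀ {U V : P2.Opens} (h : V ≤ U) (s : Γ(E, U)), s ∈ sections U → res E h s ∈ sections V
  locality : ∀ (U : P2.Opens) (s : Γ(E, U)),
    (∀ x ∈ U, ∃ (V : P2.Opens) (h : V ≤ U), x ∈ V ∧ res E h s ∈ sections V) → s ∈ sections U

/-- A sheaf of modules, as a subsheaf of itself. -/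
def Subsheaf.whole (E : P2.Modules) : Subsheaf E where
  sections _ := ⊤
  res_mem _ _ _ := trivial
  locality _ _ _ := trivial

/-- A subsheaf is of finite type if every point has an open neighbourhood `U` on which finitely
many sections generate it, that is, all its sections over open subsets of `U` are locally linear
combinations of those.  For a subsheaf of a coherent sheaf this means that it is coherent. -/
def Subsheaf.IsCoherent {E : P2.Modules} (F : Subsheaf E) : Prop :=
  ∀ x : P2, ∃ U : P2.Opens, x ∈ U ∧ ∃ (n : ℕ) (g : Fin n → Γ(E, U)), (∀ k, g k ∈ F.sections U) ∧
    ∀ (V : P2.Opens) (hV : V ≤ U), ∀ t ∈ F.sections V, ∀ y ∈ V,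
      ∃ (W : P2.Opens) (hW : W ≤ V), y ∈ W ∧
        res E hW t ∈ Submodule.span Γ(P2, W) (Set.range fun k => res E (hW.trans hV) (g k))

/-- The space of global sections `H⁰(F(m))` of the twist `F(m) = F ⊗ 𝒪(m)`.  As `𝒪(m)` is free on
the chart `Xᵢ ≠ 0` with generator `Xᵢ ^ m`, a global section of `F(m)` is a triple of sections
`sᵢ` of `F` on the charts such that `sᵢ ⊗ Xᵢ ^ m = sⱼ ⊗ Xⱼ ^ m`, that is,
`sᵢ = (Xⱼ / Xᵢ) ^ m • sⱼ`, on the intersections of the charts. -/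
def Subsheaf.twistedSections {E : P2.Modules} (F : Subsheaf E) (m : ℕ) :
    Submodule ℂ (∀ i : Fin 3, Γ(E, chart i)) where
  carrier := {s | (∀ i, s i ∈ F.sections (chart i)) ∧
    ∀ i j, res E (inf_le_left : chart i ⊓ chart j ≤ chart i) (s i) =
      P2.presheaf.map (homOfLE (inf_le_left : chart i ⊓ chart j ≤ chart i)).op (ratio i j ^ m) •
        res E (inf_le_right : chart i ⊓ chart j ≤ chart j) (s j)}
  zero_mem' := ⟨fun i => zero_mem _, fun i j => by simp [res]⟩
  add_mem' {s t} hs ht := ⟨fun i => add_mem (hs.1 i) (ht.1 i), fun i j => by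
    have h1 := hs.2 i j
    have h2 := ht.2 i j
    simp only [Pi.add_apply, res, map_add, smul_add] at h1 h2 ⊢
    rw [h1, h2]⟩
  smul_mem' c s hs := ⟨fun i => (F.sections (chart i)).smul_mem (const (chart i) c) (hs.1 i),
    fun i j => by
      have h : ∀ (U : P2.Opens) (r : Γ(P2, U)) (t : Γ(E, U)), c • r • t = r • c • t :=
        fun U r t => smul_comm (const U c) r t
      rw [Pi.smul_apply, Pi.smul_apply, res_const_smul, res_const_smul, hs.2 i j, h]⟩

/-- `p` is the Hilbert polynomial of `F`: it takes the value `dim H⁰(F(m))` at all large `m`. -/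
def Subsheaf.IsHilbertPolynomial {E : P2.Modules} (F : Subsheaf E) (p : Polynomial ℚ) : Prop :=
  ∀ᶠ m : ℕ in Filter.atTop, Module.Finite ℂ (F.twistedSections m) ∧
    (Module.finrank ℂ (F.twistedSections m) : ℚ) = p.eval (m : ℚ)

/-- The rank of a coherent sheaf on the plane with Hilbert polynomial `p = ∑ αₖ mᵏ / k!`: it is
`α₂ / α₂(𝒪)`, and `α₂(𝒪) = 1`. -/
def rank (p : Polynomial ℚ) : ℚ := 2 * p.coeff 2

/-- The degree, or first Chern class, of a coherent sheaf on the plane with Hilbert polynomial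
`p = ∑ αₖ mᵏ / k!`: it is `α₁ - rank * α₁(𝒪)`, and `α₁(𝒪) = 3 / 2`. -/
def degree (p : Polynomial ℚ) : ℚ := p.coeff 1 - rank p * (3 / 2)

/-- The slope of a coherent sheaf of positive rank with Hilbert polynomial `p`. -/
def slope (p : Polynomial ℚ) : ℚ := degree p / rank p

/-- Slope stability (in the sense of Mumford and Takemoto) of a torsion-free coherent sheaf on the
plane: every coherent subsheaf of strictly smaller positive rank has strictly smaller slope. -/
def IsStable (E : P2.Modules) : Prop :=
  ∃ p : Polynomial ℚ, (Subsheaf.whole E).IsHilbertPolynomial p ∧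
    ∀ F : Subsheaf E, F.IsCoherent → ∀ q : Polynomial ℚ, F.IsHilbertPolynomial q →
      0 < rank q → rank q < rank p → slope q < slope p

/-! ### Syzygies and smoothness -/

/-- The partial derivatives of `f` have a nonzero homogeneous syzygy of degree `e`. -/
def HasSyzygy (f : CoordRing) (e : ℕ) : Prop :=
  ∃ a : Fin 3 → CoordRing, (∀ i, (a i).IsHomogeneous e) ∧ a ≠ 0 ∧
    ∑ i, a i * MvPolynomial.pderiv i f = 0

/-- The plane curve `f = 0` is nonsingular: at each of its points some partial derivative of `f`
does not vanish. -/
def IsNonsingular (f : CoordRing) : Prop :=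
  ∀ v : Fin 3 → ℂ, v ≠ 0 → MvPolynomial.eval v f = 0 →
    ∃ i, MvPolynomial.eval v (MvPolynomial.pderiv i f) ≠ 0

end PlaneCurve

end

/-!
By Euler's relation every homogeneous derivation preserving `(f)` is, modulo the Euler field, the
image of a unique one that kills `f`, so the sections of `T⟨X⟩(m)` are the syzygies of degree
`m + 1` of the partial derivatives of `f`. As `f` is reduced, the partial derivatives have no
common factor; the quotient by them has an eventually constant Hilbert function, so that `T⟨X⟩`
has Hilbert polynomial `m ^ 2 + (6 - d) m + const`, rank two and slope `(3 - d) / 2`.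

A syzygy of degree `k` without common factor generates a subsheaf isomorphic to `𝒪(1 - k)`, and
all global sections of twists of a rank-one subsheaf are multiples of one such syzygy. Stability
therefore says that `1 - k < (3 - d) / 2` for all of them, that is, that there is no syzygy of
degree at most `(d - 1) / 2`; multiplying by powers of `X₀` brings any such syzygy into degree
`⌊(d - 1) / 2⌋`. If `X` is nonsingular, the partial derivatives generate an ideal supported at the
origin, so their syzygies are Koszul relations, which have degree at least `d - 1`.
-/

noncomputable section

namespace PlaneCurve

section Primitive

/-- A family of ring elements without common prime factor. -/
def IsPrimitive {R ι : Type*} [CommMonoidWithZero R] (F : ι → R) : Prop :=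
  ∀ p, Prime p → ∃ i, ¬ p ∣ F i

variable {R ι : Type*}

theorem IsPrimitive.exists_ne_zero [CommMonoidWithZero R] {F : ι → R} (hF : IsPrimitive F) {p : R}
    (hp : Prime p) : ∃ i, F i ≠ 0 := by
  obtain ⟨i, hi⟩ := hF p hp
  exact ⟨i, fun h => hi (h ▸ dvd_zero p)⟩

theorem IsPrimitive.of_forall_mem_span [CommRing R] {κ : Type*} {F : ι → R} {x : κ → R}
    (hx : IsPrimitive x) (h : ∀ k, x k ∈ Ideal.span (Set.range F)) : IsPrimitive F := by
  intro p hp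
  obtain ⟨k, hk⟩ := hx p hp
  by_contra! hpF
  have hle : Ideal.span (Set.range F) ≤ Ideal.span {p} :=
    Ideal.span_le.mpr (Set.range_subset_iff.mpr fun i => Ideal.mem_span_singleton.mpr (hpF i))
  exact hk (Ideal.mem_span_singleton.mp (hle (h k)))

theorem isPrimitive_of_isRelPrime [CommMonoidWithZero R] {F : ι → R} {i j : ι}
    (h : IsRelPrime (F i) (F j)) : IsPrimitive F := by
  intro p hp
  by_contra! hpF
  exact hp.not_isUnit (h (hpF i) (hpF j))

variable [CommRing R] [IsDomain R] [UniqueFactorizationMonoid R] {F : ι → R}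

theorem IsPrimitive.dvd_of_forall_dvd_mul (hF : IsPrimitive F) {a : R} (ha : a ≠ 0) {v : R}
    (hv : ∀ j, a ∣ v * F j) : a ∣ v := by
  induction a using UniqueFactorizationMonoid.induction_on_prime generalizing v with
  | h₁ => exact absurd rfl ha
  | h₂ x hx => exact hx.dvd
  | h₃ a p ha0 hp ih =>
    obtain ⟨i, hi⟩ := hF p hp
    obtain ⟨v, rfl⟩ := (hp.dvd_or_dvd ((dvd_mul_right p a).trans (hv i))).resolve_right hi
    refine mul_dvd_mul_left p (ih ha0 fun j => (mul_dvd_mul_iff_left hp.ne_zero).mp ?_)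
    exact mul_assoc p v (F j) ▸ hv j

theorem IsPrimitive.exists_eq_smul_of_proportional (hF : IsPrimitive F) {i : ι} (hi : F i ≠ 0)
    {v : ι → R} (h : ∀ j k, v j * F k = v k * F j) : ∃ w : R, v = w • F := by
  obtain ⟨w, hw⟩ := hF.dvd_of_forall_dvd_mul hi (v := v i) fun j =>
    ⟨v j, by rw [← h j i, mul_comm]⟩
  refine ⟨w, funext fun j => mul_left_cancel₀ hi ?_⟩
  rw [Pi.smul_apply, smul_eq_mul]
  linear_combination h j i + F j * hw

end Primitive

/-! ### Koszul relations of three elements -/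

section Koszul

open scoped Matrix

theorem eq_cross_iff {R : Type*} [CommRing R] {u v w : Fin 3 → R} :
    u = v ⨯₃ w ↔ u 0 = v 1 * w 2 - v 2 * w 1 ∧ u 1 = v 2 * w 0 - v 0 * w 2 ∧
      u 2 = v 0 * w 1 - v 1 * w 0 := by
  rw [cross_apply, funext_iff]
  simp only [Fin.forall_fin_succ, Fin.forall_fin_zero, and_true]
  rfl

variable {R : Type*} [CommRing R] [IsDomain R]

theorem IsPrimitive.exists_eq_smul_of_cross_eq_zero [UniqueFactorizationMonoid R]
    {F : Fin 3 → R} (hF : IsPrimitive F) {i : Fin 3} (hi : F i ≠ 0) {v : Fin 3 → R}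
    (h : v ⨯₃ F = 0) : ∃ w : R, v = w • F := by
  obtain ⟨h12, h20, h01⟩ := eq_cross_iff.mp h.symm
  refine hF.exists_eq_smul_of_proportional hi fun j k => ?_
  fin_cases j <;> fin_cases k <;> first | rfl | exact (sub_eq_zero.mp (Eq.symm ‹_›)) |
    exact (sub_eq_zero.mp (Eq.symm ‹_›)).symm

theorem exists_eq_cross_of_isRelPrime [DecompositionMonoid R] {x : Fin 3 → R} (hx : x 0 ≠ 0)
    (h01 : IsRelPrime (x 0) (x 1))
    (h2 : ∀ u, x 2 * u ∈ Ideal.span {x 0, x 1} → u ∈ Ideal.span {x 0, x 1}) {u : Fin 3 → R}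
    (hu : u ⬝ᵥ x = 0) : ∃ c : Fin 3 → R, u = c ⨯₃ x := by
  rw [Matrix.vec3_dotProduct] at hu
  obtain ⟨p, q, hpq⟩ := Ideal.mem_span_pair.mp <| h2 (u 2) <|
    Ideal.mem_span_pair.mpr ⟨-u 0, -u 1, by linear_combination (-1) * hu⟩
  have hdvd : x 0 ∣ x 1 * (u 1 + q * x 2) :=
    ⟨-(u 0 + p * x 2), by linear_combination hu + x 2 * hpq⟩
  obtain ⟨c, hc⟩ := h01.dvd_of_dvd_mul_left hdvd
  refine ⟨![q, -p, c], eq_cross_iff.mpr ⟨mul_left_cancel₀ hx ?_, ?_, ?_⟩⟩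
  all_goals simp only [Matrix.cons_val]
  · linear_combination hu + x 2 * hpq - x 1 * hc
  · linear_combination hc
  · linear_combination -hpq

theorem exists_forall_eq_smul_add_smul {x F : Fin 3 → R}
    (hx₁ : ∀ u, u ⬝ᵥ x = 0 → ∃ c : Fin 3 → R, u = c ⨯₃ x)
    (hx₂ : ∀ v, v ⨯₃ x = 0 → ∃ w : R, v = w • x) {k₀ : Fin 3} (hk₀ : F k₀ ≠ 0)
    {c : Fin 3 → Fin 3 → R} (hc : ∀ i j, ∃ w : R, x j • c i - x i • c j = w • F) :
    ∃ e u : Fin 3 → R, ∀ i, c i = e i • F + x i • u := by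
  choose w hw using hc
  have hw (i j k : Fin 3) : x j * c i k - x i * c j k = w i j * F k := congrFun (hw i j) k
  have hcocycle : ![w 1 2, w 2 0, w 0 1] ⬝ᵥ x = 0 := by
    refine mul_right_cancel₀ hk₀ ?_
    rw [Matrix.vec3_dotProduct]
    simp only [Matrix.cons_val]
    linear_combination -x 0 * hw 1 2 k₀ - x 1 * hw 2 0 k₀ - x 2 * hw 0 1 k₀
  obtain ⟨e, he⟩ := hx₁ _ hcocycle
  obtain ⟨h12, h20, h01⟩ := eq_cross_iff.mp he
  simp only [Matrix.cons_val] at h12 h20 h01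
  have hu (k : Fin 3) : ∃ u : R, (fun i => c i k - e i * F k) = u • x :=
    hx₂ _ <| Eq.symm <| eq_cross_iff.mpr
      ⟨by rw [Pi.zero_apply]; linear_combination -hw 1 2 k - F k * h12,
        by rw [Pi.zero_apply]; linear_combination -hw 2 0 k - F k * h20,
        by rw [Pi.zero_apply]; linear_combination -hw 0 1 k - F k * h01⟩
  choose u hu using hu
  refine ⟨e, u, fun i => funext fun k => ?_⟩
  have := congrFun (hu k) i
  simp only [Pi.add_apply, Pi.smul_apply, smul_eq_mul] at this ⊢
  linear_combination this

/-- The ideal of `F` kills its first Koszul homology; the homotopies `c i` that do so for the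
elements `x i` fit together along `x`. -/
theorem exists_eq_cross_of_forall_mem_span {x F : Fin 3 → R} (hx0 : x 0 ≠ 0)
    (hxF : ∀ i, x i ∈ Ideal.span (Set.range F))
    (hx₁ : ∀ u, u ⬝ᵥ x = 0 → ∃ c : Fin 3 → R, u = c ⨯₃ x)
    (hx₂ : ∀ v, v ⨯₃ x = 0 → ∃ w : R, v = w • x)
    (hF₂ : ∀ v, v ⨯₃ F = 0 → ∃ w : R, v = w • F) {a : Fin 3 → R} (ha : a ⬝ᵥ F = 0) :
    ∃ c : Fin 3 → R, a = c ⨯₃ F := by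
  choose g hg using fun i => Ideal.mem_span_range_iff_exists_fun.mp (hxF i)
  let c (i : Fin 3) : Fin 3 → R := g i ⨯₃ a
  have hc (i : Fin 3) : c i ⨯₃ F = x i • a := by
    rw [cross_cross_eq_smul_sub_smul, ha, zero_smul, sub_zero, ← hg i]
    rfl
  obtain ⟨k, hk⟩ : ∃ k, F k ≠ 0 := by
    by_contra! hF
    exact hx0 (by simp [← hg 0, hF])
  obtain ⟨e, u, hcu⟩ := exists_forall_eq_smul_add_smul hx₁ hx₂ hk (c := c) fun i j => hF₂ _ <| by
    rw [map_sub, map_smul, map_smul, LinearMap.sub_apply, LinearMap.smul_apply,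
      LinearMap.smul_apply, hc, hc, smul_comm, sub_self]
  refine ⟨u, smul_right_injective _ hx0 ?_⟩
  change x 0 • a = x 0 • u ⨯₃ F
  rw [← hc 0, hcu, map_add, map_smul, map_smul, LinearMap.add_apply, LinearMap.smul_apply,
    LinearMap.smul_apply, cross_self, smul_zero, zero_add]

end Koszul

/-! ### Partial derivatives of a plane curve -/

section Homogeneous

open MvPolynomial

variable {σ R : Type*} [CommRing R]

theorem coe_decompose_eq_homogeneousComponent (p : MvPolynomial σ R) (n : ℕ) :
    letI := gradedAlgebra (σ := σ) (R := R)
    (DirectSum.decompose (homogeneousSubmodule σ R) p n : MvPolynomial σ R) =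
      homogeneousComponent n p :=
  decomposition.decompose'_apply p n

theorem homogeneousComponent_mul_of_le {p q : MvPolynomial σ R} {e n : ℕ} (hq : q.IsHomogeneous e)
    (h : e ≤ n) : homogeneousComponent n (p * q) = homogeneousComponent (n - e) p * q := by
  let := gradedAlgebra (σ := σ) (R := R)
  simpa only [coe_decompose_eq_homogeneousComponent] using
    DirectSum.coe_decompose_mul_of_right_mem_of_le (homogeneousSubmodule σ R) (a := p) hq h

theorem homogeneousComponent_mul_of_lt {p q : MvPolynomial σ R} {e n : ℕ} (hq : q.IsHomogeneous e)
    (h : n < e) : homogeneousComponent n (p * q) = 0 := by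
  let := gradedAlgebra (σ := σ) (R := R)
  simpa only [coe_decompose_eq_homogeneousComponent] using
    DirectSum.coe_decompose_mul_of_right_mem_of_not_le (homogeneousSubmodule σ R) (a := p) hq
      h.not_ge

theorem isHomogeneous_of_mul_right [IsDomain R] {p q : MvPolynomial σ R} {e n : ℕ}
    (hq : q.IsHomogeneous e) (hq0 : q ≠ 0) (h : (p * q).IsHomogeneous (n + e)) :
    p.IsHomogeneous n := by
  have hp : homogeneousComponent n p * q = p * q := by
    conv_rhs => rw [← homogeneousComponent_eq_self h]
    rw [homogeneousComponent_mul_of_le hq (Nat.le_add_left e n), Nat.add_sub_cancel]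
  exact mul_right_cancel₀ hq0 hp ▸ homogeneousComponent_isHomogeneous n p

end Homogeneous

section PartialDerivatives

open MvPolynomial

variable {σ : Type*}

theorem totalDegree_pderiv_lt {R : Type*} [CommSemiring R] {p : MvPolynomial σ R} {i : σ}
    (h : pderiv i p ≠ 0) : (pderiv i p).totalDegree < p.totalDegree := by
  obtain ⟨m, hm, hdeg⟩ := Finset.exists_mem_eq_sup (pderiv i p).support
    (support_nonempty.mpr h) (fun s => s.sum fun _ e => e)
  have hcoeff : coeff (m + Finsupp.single i 1) p ≠ 0 := fun h0 => by
    rw [mem_support_iff, coeff_pderiv, h0, zero_mul] at hm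
    exact hm rfl
  have hle := le_totalDegree (mem_support_iff.mpr hcoeff)
  rw [Finsupp.sum_add_index' (fun _ => rfl) (fun _ _ _ => rfl), Finsupp.sum_single_index rfl,
    ← hdeg] at hle
  exact Nat.lt_of_succ_le hle

theorem eq_C_of_forall_pderiv_eq_zero {R : Type*} [CommSemiring R] [CharZero R] [NoZeroDivisors R]
    {p : MvPolynomial σ R} (h : ∀ i, pderiv i p = 0) : p = C (coeff 0 p) := by
  classical
  ext m
  rw [coeff_C]
  split_ifs with h0
  · rw [h0]
  · obtain ⟨i, hi⟩ : ∃ i, m i ≠ 0 := by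
      by_contra! hm
      exact h0 (Finsupp.ext fun i => (hm i).symm)
    have hcoeff := congrArg (coeff (m - Finsupp.single i 1)) (h i)
    rw [coeff_pderiv, coeff_zero, tsub_add_cancel_of_le (by
      rw [Finsupp.single_le_iff]; omega)] at hcoeff
    exact (mul_eq_zero.mp hcoeff).resolve_right (Nat.cast_add_one_ne_zero _)

variable {K : Type*} [Field K] [CharZero K]

theorem exists_not_dvd_pderiv_self_of_prime {p : MvPolynomial σ K} (hp : Prime p) :
    ∃ i, ¬ p ∣ pderiv i p := by
  by_contra! h
  have hzero (i : σ) : pderiv i p = 0 := by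
    by_contra hi
    exact (totalDegree_pderiv_lt hi).not_ge (totalDegree_le_of_dvd_of_isDomain (h i) hi)
  have hpC := eq_C_of_forall_pderiv_eq_zero hzero
  refine hp.not_isUnit (hpC ▸ (isUnit_iff_ne_zero.mpr fun hc => hp.ne_zero ?_).map C)
  rw [hpC, hc, C_0]

variable [Finite σ] {f : MvPolynomial σ K} {d : ℕ}

theorem isPrimitive_pderiv (hd : d ≠ 0) (hhom : f.IsHomogeneous d) (hred : Squarefree f) :
    IsPrimitive fun i => pderiv i f := by
  cases nonempty_fintype σ
  intro p hp
  by_contra! h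
  obtain ⟨g, rfl⟩ : p ∣ f := by
    have hdvd : p ∣ d • f := hhom.sum_X_mul_pderiv ▸ Finset.dvd_sum fun i _ => (h i).mul_left _
    rw [← Nat.cast_smul_eq_nsmul K, smul_eq_C_mul] at hdvd
    exact ((isUnit_iff_ne_zero.mpr (Nat.cast_ne_zero.mpr hd)).map C).dvd_mul_left.mp hdvd
  obtain ⟨i, hi⟩ := exists_not_dvd_pderiv_self_of_prime hp
  have hdvd := h i
  rw [pderiv_mul, dvd_add_left (dvd_mul_right p _)] at hdvd
  obtain ⟨k, rfl⟩ := (hp.dvd_or_dvd hdvd).resolve_left hi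
  exact hp.not_isUnit (hred p ⟨k, by ring⟩)

theorem eval_eq_zero_of_forall_eval_pderiv (hd : d ≠ 0) (hhom : f.IsHomogeneous d) {v : σ → K}
    (h : ∀ i, eval v (pderiv i f) = 0) : eval v f = 0 := by
  cases nonempty_fintype σ
  have heuler := congrArg (eval v) hhom.sum_X_mul_pderiv
  rw [map_sum, map_nsmul, Finset.sum_eq_zero fun i _ => by rw [map_mul, h, mul_zero]] at heuler
  exact (smul_eq_zero.mp heuler.symm).resolve_left hd

end PartialDerivatives

section Nonsingular

open MvPolynomial
open scoped Matrix

theorem isRelPrime_X_pow {σ R : Type*} [CommRing R] [IsDomain R] [UniqueFactorizationMonoid R]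
    {i j : σ} (h : i ≠ j) (m n : ℕ) :
    IsRelPrime (X i ^ m : MvPolynomial σ R) (X j ^ n) :=
  ((X_prime (R := R) (i := i)).irreducible.isRelPrime_iff_not_dvd.mpr (X_dvd_X.not.mpr h)).pow

theorem mem_span_X_pow_of_X_pow_mul_mem {σ R : Type*} [CommRing R] {i j k : σ}
    (hik : i ≠ k) (hjk : j ≠ k) (n : ℕ) {u : MvPolynomial σ R}
    (h : X k ^ n * u ∈ Ideal.span {(X i ^ n : MvPolynomial σ R), X j ^ n}) :
    u ∈ Ideal.span {(X i ^ n : MvPolynomial σ R), X j ^ n} := by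
  classical
  have hs : ({X i ^ n, X j ^ n} : Set (MvPolynomial σ R)) =
      (fun s => monomial s 1) '' {Finsupp.single i n, Finsupp.single j n} := by
    simp [Set.image_pair, X_pow_eq_monomial]
  rw [hs, mem_ideal_span_monomial_image] at h ⊢
  intro s hs
  have hmem : Finsupp.single k n + s ∈ (X k ^ n * u).support := by
    rw [mem_support_iff, X_pow_eq_monomial, coeff_monomial_mul, one_mul]
    exact mem_support_iff.mp hs
  obtain ⟨t, ht, hle⟩ := h _ hmem
  refine ⟨t, ht, ?_⟩
  rcases ht with rfl | rfl <;> rw [Finsupp.single_le_iff] at hle ⊢ <;>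
    simpa [Finsupp.single_apply, hik.symm, hjk.symm] using hle

theorem exists_eq_cross_of_X_pow_mem_span {R : Type*} [CommRing R] [IsDomain R]
    [UniqueFactorizationMonoid R] {F : Fin 3 → MvPolynomial (Fin 3) R} {n : ℕ}
    (hF : ∀ i, X i ^ n ∈ Ideal.span (Set.range F)) {a : Fin 3 → MvPolynomial (Fin 3) R}
    (ha : a ⬝ᵥ F = 0) : ∃ c : Fin 3 → MvPolynomial (Fin 3) R, a = c ⨯₃ F := by
  let x (i : Fin 3) : MvPolynomial (Fin 3) R := X i ^ n
  have h01 : IsRelPrime (x 0) (x 1) := isRelPrime_X_pow (by decide) n n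
  have hx0 : x 0 ≠ 0 := pow_ne_zero n (X_ne_zero 0)
  have hprim : IsPrimitive F := (isPrimitive_of_isRelPrime (F := x) h01).of_forall_mem_span hF
  obtain ⟨i, hi⟩ := hprim.exists_ne_zero (X_prime (i := 0))
  exact exists_eq_cross_of_forall_mem_span hx0 hF
    (fun _ => exists_eq_cross_of_isRelPrime hx0 h01 fun _ =>
      mem_span_X_pow_of_X_pow_mul_mem (by decide) (by decide) n)
    (fun _ => (isPrimitive_of_isRelPrime h01).exists_eq_smul_of_cross_eq_zero hx0)
    (fun _ => hprim.exists_eq_smul_of_cross_eq_zero hi) ha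

variable {f : CoordRing} {d : ℕ}

theorem exists_forall_X_pow_mem_span_pderiv (hd : d ≠ 0) (hhom : f.IsHomogeneous d)
    (h : IsNonsingular f) :
    ∃ n, ∀ i, X i ^ n ∈ Ideal.span (Set.range fun j => pderiv j f) := by
  let J : Ideal CoordRing := Ideal.span (Set.range fun j => pderiv j f)
  have hX (i : Fin 3) : X i ∈ J.radical := by
    rw [← vanishingIdeal_zeroLocus_eq_radical (K := ℂ), mem_vanishingIdeal_iff]
    intro v hv
    have hv' (j : Fin 3) : eval v (pderiv j f) = 0 :=
      mem_zeroLocus_iff.mp hv _ (Ideal.subset_span ⟨j, rfl⟩)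
    obtain rfl : v = 0 := by
      by_contra hv0
      obtain ⟨j, hj⟩ := h v hv0 (eval_eq_zero_of_forall_eval_pderiv hd hhom hv')
      exact hj (hv' j)
    simp
  choose n hn using hX
  exact ⟨∑ j, n j, fun i => J.mem_of_dvd
    (pow_dvd_pow _ (Finset.single_le_sum (fun _ _ => Nat.zero_le _) (Finset.mem_univ i))) (hn i)⟩

theorem not_hasSyzygy_of_isNonsingular {e : ℕ} (he : e + 1 < d) (hhom : f.IsHomogeneous d)
    (h : IsNonsingular f) : ¬ HasSyzygy f e := by
  rintro ⟨a, ha, ha0, hsyz⟩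
  obtain ⟨n, hn⟩ := exists_forall_X_pow_mem_span_pderiv (by omega) hhom h
  obtain ⟨c, hc⟩ := exists_eq_cross_of_X_pow_mem_span hn hsyz
  obtain ⟨h0, h1, h2⟩ := eq_cross_iff.mp hc
  have hlow (p : CoordRing) (j : Fin 3) : homogeneousComponent e (p * pderiv j f) = 0 :=
    homogeneousComponent_mul_of_lt hhom.pderiv (by omega)
  refine ha0 (funext fun i => ?_)
  rw [← homogeneousComponent_eq_self (ha i)]
  fin_cases i
  · simp only [Fin.zero_eta, h0, map_sub, hlow, sub_zero, Pi.zero_apply]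
  · simp only [Fin.mk_one, h1, map_sub, hlow, sub_zero, Pi.zero_apply]
  · simp only [Fin.reduceFinMk, h2, map_sub, hlow, sub_zero, Pi.zero_apply]

end Nonsingular

/-! ### Dimensions of spaces of syzygies -/

section GenericCombination

open MvPolynomial

theorem exists_forall_sum_smul_notMem {K M ι κ : Type*} [Field K] [Infinite K] [AddCommGroup M]
    [Module K M] [Fintype ι] [Finite κ] {x : ι → M} {W : κ → Submodule K M}
    (hW : ∀ k, ∃ i, x i ∉ W k) : ∃ c : ι → K, ∀ k, ∑ i, c i • x i ∉ W k := by
  classical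
  refine Submodule.exists_forall_notMem_of_forall_ne_top
    (fun k => (W k).comap (Fintype.linearCombination K x)) fun k htop => ?_
  obtain ⟨i, hi⟩ := hW k
  refine hi ?_
  have h : Pi.single i 1 ∈ (W k).comap (Fintype.linearCombination K x) :=
    htop ▸ Submodule.mem_top
  rwa [Submodule.mem_comap, Fintype.linearCombination_apply_single, one_smul] at h

theorem IsPrimitive.exists_isRelPrime_sum_smul {K R ι : Type*} [Field K] [Infinite K] [CommRing R]
    [IsDomain R] [UniqueFactorizationMonoid R] [Algebra K R] [Fintype ι] {F : ι → R}
    (hF : IsPrimitive F) {p : R} (hp : p ≠ 0) :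
    ∃ c : ι → K, IsRelPrime p (∑ j, c j • F j) := by
  classical
  let s := (UniqueFactorizationMonoid.factors p).toFinset
  obtain ⟨c, hc⟩ := exists_forall_sum_smul_notMem (K := K) (x := F)
    (W := fun g : s => (Ideal.span {(g : R)}).restrictScalars K) fun g => by
      obtain ⟨i, hi⟩ := hF g (UniqueFactorizationMonoid.prime_of_factor _
        (Multiset.mem_toFinset.mp g.2))
      exact ⟨i, fun h => hi (Ideal.mem_span_singleton.mp h)⟩
  refine ⟨c, (UniqueFactorizationMonoid.isRelPrime_iff_no_prime_factors hp).mpr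
    fun g hgp hgc hg => ?_⟩
  obtain ⟨g', hg', hass⟩ :=
    UniqueFactorizationMonoid.exists_mem_factors_of_dvd hp hg.irreducible hgp
  exact hc ⟨g', Multiset.mem_toFinset.mpr hg'⟩
    (Ideal.mem_span_singleton.mpr (hass.symm.dvd.trans hgc))

variable {σ K : Type*} [Field K] [Infinite K] [Finite σ]

theorem exists_isHomogeneous_one_forall_notMem {s : Set (Ideal (MvPolynomial σ K))}
    (hs : s.Finite) :
    ∃ l : MvPolynomial σ K, l.IsHomogeneous 1 ∧ ∀ P ∈ s, l ∈ P → ∀ i, X i ∈ P := by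
  cases nonempty_fintype σ
  let t := {P ∈ s | ∃ i, X i ∉ P}
  have : Finite t := hs.subset (Set.sep_subset _ _)
  obtain ⟨c, hc⟩ := exists_forall_sum_smul_notMem (K := K) (x := X)
    (W := fun P : t => P.1.restrictScalars K) fun P => P.2.2
  refine ⟨∑ i, c i • X i, IsHomogeneous.sum _ _ _ fun i _ =>
    (homogeneousSubmodule σ K 1).smul_mem _ (isHomogeneous_X K i), fun P hP hl => ?_⟩
  by_contra! hX
  exact hc ⟨P, hP, hX⟩ hl

theorem exists_isHomogeneous_one_forall_mul_mem_of_mul_mem (I : Ideal (MvPolynomial σ K)) :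
    ∃ l : MvPolynomial σ K, l.IsHomogeneous 1 ∧ ∃ N, ∀ u, u * l ∈ I →
      ∀ v ∈ idealOfVars σ K ^ N, v * u ∈ I := by
  let R := MvPolynomial σ K
  -- Avoiding the associated primes of `R ⧸ I`, `l` has a kernel supported at the origin only.
  obtain ⟨l, hl, hlP⟩ := exists_isHomogeneous_one_forall_notMem (associatedPrimes.finite R (R ⧸ I))
  refine ⟨l, hl, ?_⟩
  let M := LinearMap.ker (LinearMap.lsmul R (R ⧸ I) l)
  have hrad : idealOfVars σ K ≤ (Module.annihilator R M).radical := by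
    rw [idealOfVars, Ideal.span_le, ← Ideal.sInf_minimalPrimes]
    rintro _ ⟨i, rfl⟩
    refine Ideal.mem_sInf.mpr fun {P} hP => hlP P ?_ ?_ i
    · exact associatedPrimes.subset_of_injective (f := M.subtype) M.injective_subtype
        (Module.associatedPrimes.minimalPrimes_annihilator_subset_associatedPrimes _ _ hP)
    · exact hP.1.2 (Module.mem_annihilator.mpr fun m => Subtype.ext m.2)
  obtain ⟨N, hN⟩ := Ideal.exists_pow_le_of_le_radical_of_fg hrad (idealOfVars_fg _ _)
  have smul_mk (a b : R) : a • Ideal.Quotient.mk I b = 0 ↔ a * b ∈ I :=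
    Ideal.Quotient.eq_zero_iff_mem (a := a * b)
  refine ⟨N, fun u hu v hv => (smul_mk v u).mp ?_⟩
  have huM : Ideal.Quotient.mk I u ∈ M := (smul_mk l u).mpr (mul_comm u l ▸ hu)
  exact congrArg Subtype.val (Module.mem_annihilator.mp (hN hv) ⟨_, huM⟩)

theorem exists_isHomogeneous_one_forall_mem_of_mul_mem (I : Ideal (MvPolynomial σ K)) :
    ∃ l : MvPolynomial σ K, l.IsHomogeneous 1 ∧ ∃ N, ∀ n ≥ N, ∀ u : MvPolynomial σ K,
      u.IsHomogeneous n → u * l ∈ I → u ∈ I := by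
  obtain ⟨l, hl, N, hN⟩ := exists_isHomogeneous_one_forall_mul_mem_of_mul_mem I
  refine ⟨l, hl, ?_⟩
  let T : ℕ →o Ideal (MvPolynomial σ K) :=
    { toFun n := Ideal.span {u | u * l ∈ I ∧ ∃ k ≤ n, u.IsHomogeneous k}
      monotone' m n h := Ideal.span_mono fun u hu =>
        ⟨hu.1, hu.2.imp fun k hk => ⟨hk.1.trans h, hk.2⟩⟩ }
  obtain ⟨D, hD⟩ := monotone_stabilizes_iff_noetherian.mpr
    (inferInstance : IsNoetherianRing (MvPolynomial σ K)) T
  refine ⟨D + N, fun n hn u hu hul => ?_⟩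
  have huT : u ∈ T D := by
    rw [hD n (by omega)]
    exact Ideal.subset_span ⟨hul, n, le_rfl, hu⟩
  obtain ⟨c, hc, hsum⟩ := Submodule.mem_span_set.mp huT
  rw [← homogeneousComponent_eq_self hu, ← hsum, Finsupp.sum, map_sum]
  refine Ideal.sum_mem _ fun k hk => ?_
  obtain ⟨hkl, e, he, hke⟩ := hc hk
  rw [smul_eq_mul, homogeneousComponent_mul_of_le hke (by omega)]
  refine hN k hkl _ ((mem_pow_idealOfVars_iff' _ _).mpr fun s hs => ?_)
  exact (homogeneousComponent_isHomogeneous (n - e) (c k)).coeff_eq_zero (by omega)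

end GenericCombination

section HilbertFunctions

open MvPolynomial Filter

theorem finrank_homogeneousSubmodule (σ R : Type*) [Fintype σ] [CommRing R] [Nontrivial R] (n : ℕ) :
    Module.finrank R (homogeneousSubmodule σ R n) = (Fintype.card σ + n - 1).choose n := by
  classical
  rw [homogeneousSubmodule_eq_finsupp_supported]
  rw [(AddMonoidAlgebra.supportedEquivFinsupp (S := R) (R := R)
    {d : σ →₀ ℕ | d.degree = n}).finrank_eq]
  have hs : {d : σ →₀ ℕ | d.degree = n} =
      (Finset.univ.finsuppAntidiag n : Finset (σ →₀ ℕ)) := by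
    ext d
    simp [Finset.mem_finsuppAntidiag, Finsupp.degree_eq_sum]
  rw [hs, Module.finrank_finsupp_self, ← Nat.card_eq_fintype_card, Nat.card_coe_set_eq,
    Set.ncard_coe_finset, Finset.card_finsuppAntidiag_nat_eq_choose, Finset.card_univ]

theorem finrank_homogeneousSubmodule_fin_three (R : Type*) [CommRing R] [Nontrivial R] (n : ℕ) :
    Module.finrank R (homogeneousSubmodule (Fin 3) R n) = (n + 2).choose 2 := by
  rw [finrank_homogeneousSubmodule, Fintype.card_fin, show 3 + n - 1 = n + 2 by omega,
    Nat.choose_symm_add]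

instance (σ R : Type*) [Finite σ] [CommRing R] (n : ℕ) :
    Module.Finite R (homogeneousSubmodule σ R n) :=
  Module.Finite.iff_fg.mpr (homogeneousSubmodule_fg σ R n)

/-- The homogeneous elements of degree `n` of an ideal. -/
def gradedPart {σ R : Type*} [CommRing R] (I : Ideal (MvPolynomial σ R)) (n : ℕ) :
    Submodule R (homogeneousSubmodule σ R n) :=
  (I.restrictScalars R).comap (homogeneousSubmodule σ R n).subtype

/-- Multiplication by a homogeneous polynomial, as a map between graded pieces. -/
def mulHom {σ R : Type*} [CommRing R] {p : MvPolynomial σ R} {e : ℕ} (hp : p.IsHomogeneous e)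
    (n : ℕ) : homogeneousSubmodule σ R n →ₗ[R] homogeneousSubmodule σ R (n + e) where
  toFun u := ⟨u * p, u.2.mul hp⟩
  map_add' _ _ := Subtype.ext (add_mul _ _ _)
  map_smul' c _ := Subtype.ext (smul_mul_assoc c _ _)

variable {σ K : Type*} [Field K]

theorem ker_coprod_mulHom_le_range {p q : MvPolynomial σ K} {e : ℕ} (hp : p.IsHomogeneous e)
    (hq : q.IsHomogeneous e) (hp0 : p ≠ 0) (hpq : IsRelPrime p q) (k : ℕ) :
    LinearMap.ker ((mulHom hp (k + e)).coprod (mulHom hq (k + e))) ≤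
      LinearMap.range ((mulHom hq k).prod (-mulHom hp k)) := by
  rintro ⟨u, v⟩ huv
  have h : (u : MvPolynomial σ K) * p + v * q = 0 := congrArg Subtype.val huv
  obtain ⟨w, hw⟩ := hpq.dvd_of_dvd_mul_right (y := (v : MvPolynomial σ K))
    ⟨-u, by linear_combination h⟩
  have hwk : (-w).IsHomogeneous k := by
    refine isHomogeneous_of_mul_right hp hp0 ?_
    rw [neg_mul, mul_comm, ← hw]
    exact v.2.neg
  refine ⟨⟨-w, hwk⟩, Prod.ext (Subtype.ext (mul_right_cancel₀ hp0 ?_)) (Subtype.ext ?_)⟩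
  · change -w * q * p = u * p
    linear_combination (-1) * h + q * hw
  · change -(-w * p) = v
    rw [hw]; ring

/-- The right-hand side is the Bézout number. -/
theorem finrank_homogeneousSubmodule_quotient_gradedPart_le {p q : MvPolynomial (Fin 3) K} {e : ℕ}
    (hp : p.IsHomogeneous e) (hq : q.IsHomogeneous e) (hp0 : p ≠ 0) (hpq : IsRelPrime p q)
    {I : Ideal (MvPolynomial (Fin 3) K)} (hpI : p ∈ I) (hqI : q ∈ I) (k : ℕ) :
    Module.finrank K (homogeneousSubmodule (Fin 3) K (k + e + e) ⧸ gradedPart I (k + e + e)) ≤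
      e ^ 2 := by
  let φ := (mulHom hp (k + e)).coprod (mulHom hq (k + e))
  let ψ := (mulHom hq k).prod (-mulHom hp k)
  have hφ : LinearMap.range φ ≤ gradedPart I (k + e + e) := by
    rintro _ ⟨⟨u, v⟩, rfl⟩
    exact I.add_mem (I.mul_mem_left _ hpI) (I.mul_mem_left _ hqI)
  have hquot := (gradedPart I (k + e + e)).finrank_quotient_add_finrank
  have hrange := Submodule.finrank_mono hφ
  have hker : Module.finrank K (LinearMap.ker φ) ≤ Module.finrank K (LinearMap.range ψ) :=
    Submodule.finrank_mono (ker_coprod_mulHom_le_range hp hq hp0 hpq k)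
  have hψ := LinearMap.finrank_range_le ψ
  have hφφ := LinearMap.finrank_range_add_finrank_ker φ
  rw [Module.finrank_prod] at hφφ
  simp only [finrank_homogeneousSubmodule_fin_three] at hquot hψ hφφ
  have hchoose :
      (k + e + e + 2).choose 2 + (k + 2).choose 2 = 2 * (k + e + 2).choose 2 + e ^ 2 := by
    rify
    simp only [Nat.cast_choose_two]
    push_cast
    ring
  omega

theorem finrank_quotient_gradedPart_le_succ {I : Ideal (MvPolynomial σ K)} [Finite σ]
    {l : MvPolynomial σ K} (hl : l.IsHomogeneous 1) {n : ℕ}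
    (h : ∀ u : MvPolynomial σ K, u.IsHomogeneous n → u * l ∈ I → u ∈ I) :
    Module.finrank K (homogeneousSubmodule σ K n ⧸ gradedPart I n) ≤
      Module.finrank K (homogeneousSubmodule σ K (n + 1) ⧸ gradedPart I (n + 1)) := by
  have hle : gradedPart I n ≤ (gradedPart I (n + 1)).comap (mulHom hl n) :=
    fun u hu => I.mul_mem_right l hu
  refine LinearMap.finrank_le_finrank_of_injective
    (f := Submodule.mapQ _ _ (mulHom hl n) hle) ((injective_iff_map_eq_zero _).mpr fun u hu => ?_)
  obtain ⟨u, rfl⟩ := Submodule.Quotient.mk_surjective _ u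
  rw [Submodule.mapQ_apply, Submodule.Quotient.mk_eq_zero] at hu
  exact (Submodule.Quotient.mk_eq_zero _).mpr (h u u.2 hu)

theorem exists_eventually_eq_of_le_succ {c : ℕ → ℕ} {N B : ℕ}
    (hmono : ∀ n ≥ N, c n ≤ c (n + 1)) (hB : ∀ n ≥ N, c n ≤ B) :
    ∃ t, ∀ᶠ n in atTop, c n = t := by
  have hmono' : Monotone fun k => c (N + k) := monotone_nat_of_le_succ fun k => hmono _ (by omega)
  have hbdd : BddAbove (Set.range fun k => c (N + k)) :=
    ⟨B, Set.forall_mem_range.mpr fun k => hB _ (by omega)⟩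
  obtain ⟨k, hk⟩ := Nat.sSup_mem (Set.range_nonempty fun k => c (N + k)) hbdd
  refine ⟨c (N + k), eventually_atTop.mpr ⟨N + k, fun n hn => ?_⟩⟩
  obtain ⟨j, rfl⟩ := Nat.exists_eq_add_of_le (show N ≤ n by omega)
  exact le_antisymm ((le_csSup hbdd ⟨j, rfl⟩).trans_eq hk.symm) (hmono' (by omega))

theorem IsPrimitive.exists_finrank_quotient_gradedPart_eq [Infinite K] {ι : Type*} [Finite ι]
    {F : ι → MvPolynomial (Fin 3) K} (hF : IsPrimitive F) {e : ℕ}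
    (hhom : ∀ i, (F i).IsHomogeneous e) :
    ∃ t, ∀ᶠ n in atTop, Module.finrank K
      (homogeneousSubmodule (Fin 3) K n ⧸ gradedPart (Ideal.span (Set.range F)) n) = t := by
  cases nonempty_fintype ι
  let I := Ideal.span (Set.range F)
  have hFI (j : ι) : F j ∈ I := Ideal.subset_span ⟨j, rfl⟩
  obtain ⟨i, hi⟩ := hF.exists_ne_zero (X_prime (i := 0))
  obtain ⟨c, hc⟩ := hF.exists_isRelPrime_sum_smul (K := K) hi
  have hsum : (∑ j, c j • F j).IsHomogeneous e :=
    IsHomogeneous.sum _ _ _ fun j _ => (homogeneousSubmodule (Fin 3) K e).smul_mem _ (hhom j)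
  have hsumI : ∑ j, c j • F j ∈ I :=
    I.sum_mem fun j _ => (I.restrictScalars K).smul_mem (c j) (hFI j)
  obtain ⟨l, hl, N, hN⟩ := exists_isHomogeneous_one_forall_mem_of_mul_mem I
  refine exists_eventually_eq_of_le_succ (N := N + e + e) (B := e ^ 2) (fun n hn => ?_)
    fun n hn => ?_
  · exact finrank_quotient_gradedPart_le_succ hl fun u hu => hN n (by omega) u hu
  · obtain ⟨k, rfl⟩ := Nat.exists_eq_add_of_le' (show e + e ≤ n by omega)
    rw [← add_assoc]
    exact finrank_homogeneousSubmodule_quotient_gradedPart_le (hhom i) hsum hi hc (hFI i) hsumI k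

end HilbertFunctions

section Syzygies

open MvPolynomial Filter

variable {σ ι K : Type*} [Fintype ι] [Field K]

/-- The space of homogeneous syzygies of degree `n` of a family of polynomials. -/
def syzygies (F : ι → MvPolynomial σ K) (n : ℕ) : Submodule K (ι → MvPolynomial σ K) where
  carrier := {b | (∀ i, (b i).IsHomogeneous n) ∧ ∑ i, b i * F i = 0}
  zero_mem' := ⟨fun _ => isHomogeneous_zero _ _ _, by simp⟩
  add_mem' ha hb := ⟨fun i => (ha.1 i).add (hb.1 i), by
    simp only [Pi.add_apply, add_mul, Finset.sum_add_distrib, ha.2, hb.2, add_zero]⟩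
  smul_mem' c b hb := ⟨fun i => (homogeneousSubmodule σ K n).smul_mem c (hb.1 i), by
    simp only [Pi.smul_apply, smul_mul_assoc, ← Finset.smul_sum, hb.2, smul_zero]⟩

/-- The linear map `u ↦ ∑ i, u i * F i` on families of forms of degree `n`. -/
def combination {F : ι → MvPolynomial σ K} {e : ℕ} (hhom : ∀ i, (F i).IsHomogeneous e) (n : ℕ) :
    (ι → homogeneousSubmodule σ K n) →ₗ[K] homogeneousSubmodule σ K (n + e) :=
  ∑ i, mulHom (hhom i) n ∘ₗ LinearMap.proj i

variable {F : ι → MvPolynomial σ K} {e : ℕ} (hhom : ∀ i, (F i).IsHomogeneous e) (n : ℕ)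

theorem coe_combination_apply (u : ι → homogeneousSubmodule σ K n) :
    (combination hhom n u : MvPolynomial σ K) = ∑ i, (u i : MvPolynomial σ K) * F i := by
  simp [combination, mulHom]

theorem range_combination :
    LinearMap.range (combination hhom n) = gradedPart (Ideal.span (Set.range F)) (n + e) := by
  ext u
  change _ ↔ (u : MvPolynomial σ K) ∈ Ideal.span (Set.range F)
  rw [Ideal.mem_span_range_iff_exists_fun]
  refine ⟨?_, fun ⟨c, hc⟩ => ?_⟩
  · rintro ⟨v, rfl⟩
    exact ⟨fun i => v i, (coe_combination_apply hhom n v).symm⟩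
  · refine ⟨fun i => ⟨homogeneousComponent n (c i), homogeneousComponent_isHomogeneous _ _⟩,
      Subtype.ext ?_⟩
    rw [coe_combination_apply, ← homogeneousComponent_eq_self u.2, ← hc, map_sum]
    refine Finset.sum_congr rfl fun i _ => ?_
    rw [homogeneousComponent_mul_of_le (hhom i) (Nat.le_add_left e n), Nat.add_sub_cancel]

/-- Syzygies of degree `n` as the kernel of `combination`. -/
def kerCombinationEquiv : LinearMap.ker (combination hhom n) ≃ₗ[K] syzygies F n where
  toFun u := ⟨fun i => u.1 i, fun i => (u.1 i).2,
    (coe_combination_apply hhom n u.1).symm.trans (congrArg Subtype.val u.2)⟩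
  map_add' _ _ := rfl
  map_smul' _ _ := rfl
  invFun b := ⟨fun i => ⟨b.1 i, b.2.1 i⟩,
    Subtype.ext ((coe_combination_apply hhom n _).trans b.2.2)⟩

include hhom in
theorem finite_syzygies [Finite σ] : Module.Finite K (syzygies F n) :=
  Module.Finite.equiv (kerCombinationEquiv hhom n)

theorem IsPrimitive.exists_finrank_syzygies_eq [Infinite K] {F : Fin 3 → MvPolynomial (Fin 3) K}
    (hF : IsPrimitive F) {e : ℕ} (hhom : ∀ i, (F i).IsHomogeneous e) :
    ∃ t, ∀ᶠ n in atTop,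
      Module.finrank K (syzygies F n) + (n + e + 2).choose 2 = 3 * (n + 2).choose 2 + t := by
  obtain ⟨t, ht⟩ := hF.exists_finrank_quotient_gradedPart_eq hhom
  refine ⟨t, ((tendsto_add_atTop_nat e).eventually ht).mono fun n hn => ?_⟩
  have hcomb := LinearMap.finrank_range_add_finrank_ker (combination hhom n)
  have hquot := (gradedPart (Ideal.span (Set.range F)) (n + e)).finrank_quotient_add_finrank
  rw [(kerCombinationEquiv hhom n).finrank_eq, range_combination, Module.finrank_pi_fintype]
    at hcomb
  simp only [finrank_homogeneousSubmodule_fin_three, Finset.sum_const, Finset.card_univ,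
    Fintype.card_fin, smul_eq_mul, hn] at hcomb hquot
  omega

end Syzygies

/-! ### Germs of regular functions as rational functions -/

section Germs

open MvPolynomial

/-- The field of fractions of the homogeneous coordinate ring, in which the local rings at all
points of the plane can be compared. -/
abbrev FracField : Type := FractionRing CoordRing

/-- The inclusion of the homogeneous coordinate ring into its field of fractions. -/
abbrev toFrac : CoordRing →+* FracField := algebraMap CoordRing FracField

theorem toFrac_injective : Function.Injective toFrac := IsFractionRing.injective CoordRing FracField

theorem toFrac_ne_zero {a : CoordRing} (h : a ≠ 0) : toFrac a ≠ 0 :=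
  (map_ne_zero_iff toFrac toFrac_injective).mpr h

theorem toFrac_X_ne_zero (i : Fin 3) : toFrac (X i) ≠ 0 := toFrac_ne_zero (X_ne_zero i)

theorem ne_zero_of_notMem {x : P2} {a : CoordRing} (h : a ∉ pointIdeal x) : a ≠ 0 := by
  rintro rfl
  exact h (zero_mem _)

theorem mul_notMem {x : P2} {a b : CoordRing} (ha : a ∉ pointIdeal x) (hb : b ∉ pointIdeal x) :
    a * b ∉ pointIdeal x :=
  (pointIdeal x).primeCompl.mul_mem ha hb

theorem X_pow_notMem {x : P2} {i : Fin 3} (h : x ∈ chart i) (n : ℕ) :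
    (X i ^ n : CoordRing) ∉ pointIdeal x :=
  (pointIdeal x).primeCompl.pow_mem h n

/-- The inclusion of the localization of the coordinate ring at a point into the field of
fractions, which identifies germs at different points that are given by the same fraction. -/
def locToFrac (x : P2) : Localization (pointIdeal x).primeCompl →+* FracField :=
  IsLocalization.lift (M := (pointIdeal x).primeCompl) (g := toFrac) fun c =>
    (toFrac_ne_zero (ne_zero_of_notMem c.2)).isUnit

theorem locToFrac_mk (x : P2) (a : CoordRing) (c : (pointIdeal x).primeCompl) :
    locToFrac x (Localization.mk a c) = toFrac a / toFrac c := by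
  rw [Localization.mk_eq_mk', locToFrac, IsLocalization.lift_mk'_spec,
    mul_div_cancel₀ _ (toFrac_ne_zero (ne_zero_of_notMem c.2))]

theorem locToFrac_injective (x : P2) : Function.Injective (locToFrac x) :=
  (IsLocalization.lift_injective_iff _).mpr fun _ _ =>
    (IsLocalization.injective _ (pointIdeal x).primeCompl_le_nonZeroDivisors).eq_iff.trans
      toFrac_injective.eq_iff.symm

theorem locToFrac_algebraMap (x : P2) (c : ℂ) :
    locToFrac x (algebraMap ℂ (LocalRing x) c).val = algebraMap ℂ FracField c := by
  have hc : algebraMap ℂ (LocalRing x) c =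
    .mk ⟨0, algebraMap ℂ (grading 0) c, ⟨1, SetLike.GradedOne.one_mem⟩, one_mem _⟩ := rfl
  rw [hc, HomogeneousLocalization.val_mk, locToFrac_mk]
  simp only [map_one, div_one]
  exact (IsScalarTower.algebraMap_apply ℂ CoordRing FracField c).symm

/-- A germ of a regular function as an element of the field of fractions of the homogeneous
coordinate ring. -/
def germToFrac (x : P2) : LocalRing x →ₐ[ℂ] FracField :=
  { toRingHom :=
      (locToFrac x).comp (algebraMap (LocalRing x) (Localization (pointIdeal x).primeCompl))
    commutes' := locToFrac_algebraMap x }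

theorem germToFrac_apply (x : P2) (s : LocalRing x) : germToFrac x s = locToFrac x s.val := rfl

theorem germToFrac_injective (x : P2) : Function.Injective (germToFrac x) :=
  (locToFrac_injective x).comp (HomogeneousLocalization.val_injective _)

instance (x : P2) : IsDomain (LocalRing x) := (germToFrac_injective x).isDomain

theorem germToFrac_mk (x : P2)
    (c : HomogeneousLocalization.NumDenSameDeg grading (pointIdeal x).primeCompl) :
    germToFrac x (.mk c) = toFrac c.num / toFrac c.den := by
  rw [germToFrac_apply, HomogeneousLocalization.val_mk, locToFrac_mk]

theorem exists_germToFrac_eq {x : P2} (s : LocalRing x) :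
    ∃ (n : ℕ) (a c : CoordRing), a.IsHomogeneous n ∧ c.IsHomogeneous n ∧ c ∉ pointIdeal x ∧
      germToFrac x s = toFrac a / toFrac c := by
  obtain ⟨y, rfl⟩ := HomogeneousLocalization.mk_surjective s
  exact ⟨y.deg, y.num, y.den, y.num.2, y.den.2, y.den_mem, germToFrac_mk x y⟩

theorem exists_germ {x : P2} {n : ℕ} {a c : CoordRing} (ha : a.IsHomogeneous n)
    (hc : c.IsHomogeneous n) (hx : c ∉ pointIdeal x) :
    ∃ s, germToFrac x s = toFrac a / toFrac c :=
  ⟨.mk ⟨n, ⟨a, ha⟩, ⟨c, hc⟩, hx⟩, germToFrac_mk x _⟩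

theorem mem_curveIdeal {f : CoordRing} {x : P2} {s : LocalRing x} :
    s ∈ curveIdeal f x ↔ ∃ p c : CoordRing, c ∉ pointIdeal x ∧
      germToFrac x s = toFrac f * (toFrac p / toFrac c) := by
  have hf (z : Localization (pointIdeal x).primeCompl) :
      locToFrac x (algebraMap CoordRing _ f * z) = toFrac f * locToFrac x z := by
    rw [map_mul, locToFrac, IsLocalization.lift_eq]
  rw [curveIdeal, Ideal.mem_comap, Ideal.map_span, Set.image_singleton, Ideal.mem_span_singleton]
  constructor
  · rintro ⟨z, hz⟩
    induction z using Localization.induction_on with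
    | H y =>
      refine ⟨y.1, y.2, y.2.2, ?_⟩
      rw [← locToFrac_mk, ← hf, ← hz]
      rfl
  · rintro ⟨p, c, hc, h⟩
    refine ⟨Localization.mk p ⟨c, hc⟩, locToFrac_injective x ?_⟩
    rw [hf, locToFrac_mk]
    exact h

/-- The germ of a regular function at a point. -/
def sectionAt {U : P2.Opens} (s : Γ(P2, U)) (x : P2) (hx : x ∈ U) : LocalRing x := s.1 ⟨x, hx⟩

theorem germToFrac_ratio {i : Fin 3} (j : Fin 3) {x : P2} (hx : x ∈ chart i) :
    germToFrac x (sectionAt (ratio i j) x hx) = toFrac (X j) / toFrac (X i) :=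
  germToFrac_mk x _

theorem exists_section {U : P2.Opens} (g : ∀ x ∈ U, LocalRing x)
    (h : ∀ x ∈ U, ∃ (V : P2.Opens) (_ : V ≤ U) (n : ℕ) (a b : CoordRing), x ∈ V ∧
      a.IsHomogeneous n ∧ b.IsHomogeneous n ∧ ∀ (y : P2) (_ : y ∈ V) (hU : y ∈ U),
        b ∉ pointIdeal y ∧ germToFrac y (g y hU) = toFrac a / toFrac b) :
    ∃ t : Γ(P2, U), ∀ x hx, sectionAt t x hx = g x hx := by
  refine ⟨⟨fun x => g x.1 x.2, fun x => ?_⟩, fun _ _ => rfl⟩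
  obtain ⟨V, hV, n, a, b, hx, ha, hb, hab⟩ := h x.1 x.2
  have hb' (y : V) : b ∉ pointIdeal y.1 := (hab y.1 y.2 (hV y.2)).1
  have hg (y : V) : g y.1 (hV y.2) = .mk ⟨n, ⟨a, ha⟩, ⟨b, hb⟩, hb' y⟩ :=
    germToFrac_injective y.1 (by rw [(hab y.1 y.2 (hV y.2)).2, germToFrac_mk])
  exact ⟨V, hx, homOfLE hV, n, ⟨a, ha⟩, ⟨b, hb⟩, hb', hg⟩

theorem exists_section_of_fraction {U : P2.Opens} {n : ℕ} {a b : CoordRing}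
    (ha : a.IsHomogeneous n) (hb : b.IsHomogeneous n) (h : ∀ x ∈ U, b ∉ pointIdeal x) :
    ∃ t : Γ(P2, U), ∀ x hx, germToFrac x (sectionAt t x hx) = toFrac a / toFrac b := by
  choose g hg using fun x hx => exists_germ ha hb (h x hx)
  obtain ⟨t, ht⟩ := exists_section g fun x hx =>
    ⟨U, le_rfl, n, a, b, hx, ha, hb, fun y _ hy => ⟨h y hy, hg y hy⟩⟩
  exact ⟨t, fun x hx => (congrArg _ (ht x hx)).trans (hg x hx)⟩

theorem exists_local_fraction {U : P2.Opens} (s : Γ(P2, U)) {x : P2} (hx : x ∈ U) :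
    ∃ (V : P2.Opens) (_ : V ≤ U) (n : ℕ) (a b : CoordRing), x ∈ V ∧
      a.IsHomogeneous n ∧ b.IsHomogeneous n ∧ ∀ (y : P2) (_ : y ∈ V) (hU : y ∈ U),
        b ∉ pointIdeal y ∧ germToFrac y (sectionAt s y hU) = toFrac a / toFrac b := by
  obtain ⟨V, hx, i, n, a, b, hb, hab⟩ := s.2 ⟨x, hx⟩
  refine ⟨V, i.le, n, a, b, hx, a.2, b.2, fun y hy hU => ⟨hb ⟨y, hy⟩, ?_⟩⟩
  have h : sectionAt s y hU = _ := hab ⟨y, hy⟩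
  rw [h]
  exact germToFrac_mk y _

theorem exists_chart_fraction {i : Fin 3} (s : Γ(P2, chart i)) :
    ∃ (n : ℕ) (a : CoordRing), a.IsHomogeneous n ∧
      ∀ x hx, germToFrac x (sectionAt s x hx) = toFrac a / toFrac (X i) ^ n := by
  let e := Proj.basicOpenIsoAway grading (X i) (isHomogeneous_X ℂ i) one_pos
  obtain ⟨z, rfl⟩ : ∃ z, e.hom z = s := ⟨e.inv s, by simp⟩
  obtain ⟨n, a, ha, rfl⟩ :=
    HomogeneousLocalization.Away.mk_surjective grading (isHomogeneous_X ℂ i) z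
  refine ⟨n, a, by simpa using ha, fun x hx => ?_⟩
  rw [← map_pow]
  exact germToFrac_mk x ⟨n • 1, ⟨a, ha⟩, ⟨X i ^ n, SetLike.pow_mem_graded n (isHomogeneous_X ℂ i)⟩,
    X_pow_notMem hx n⟩

end Germs

/-! ### Points of the plane -/

section Points

open MvPolynomial

theorem exists_le_pointIdeal {I : Ideal CoordRing} (hI : I.IsHomogeneous grading) {i : Fin 3}
    (h : X i ∉ I.radical) : ∃ x : P2, I ≤ pointIdeal x := by
  rw [Ideal.radical_eq_sInf, Ideal.mem_sInf] at h
  push Not at h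
  obtain ⟨P, ⟨hIP, hP⟩, hiP⟩ := h
  have hle : (P.homogeneousCore grading).toIdeal ≤ P := Ideal.toIdeal_homogeneousCore_le grading P
  refine ⟨⟨P.homogeneousCore grading, hP.homogeneousCore, fun hirr => hiP (hle (hirr ?_))⟩, ?_⟩
  · exact HomogeneousIdeal.mem_irrelevant_of_mem grading one_pos (isHomogeneous_X ℂ i)
  · rw [← hI.toIdeal_homogeneousCore_eq_self]
    exact Ideal.homogeneousCore_mono grading hIP

theorem exists_mem_chart (x : P2) : ∃ i, x ∈ chart i := by
  by_contra! h
  have hX (i : Fin 3) : (X i : CoordRing) ∈ pointIdeal x := not_not.mp (h i)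
  refine x.not_irrelevant_le ((HomogeneousIdeal.toIdeal_irrelevant_le grading).mpr
    fun n hn p hp => ?_)
  have hsum : n • p ∈ pointIdeal x := by
    rw [← IsHomogeneous.sum_X_mul_pderiv hp]
    exact sum_mem fun i _ => Ideal.mul_mem_right _ _ (hX i)
  have hn' : (n : ℂ) ≠ 0 := Nat.cast_ne_zero.mpr hn.ne'
  rw [← Nat.cast_smul_eq_nsmul ℂ] at hsum
  simpa [smul_smul, hn'] using Submodule.smul_of_tower_mem (pointIdeal x) (n : ℂ)⁻¹ hsum

/-- The generic point of the plane, which lies on all charts. -/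
def genericPoint : P2 where
  asHomogeneousIdeal := ⊥
  isPrime := Ideal.isPrime_bot
  not_irrelevant_le h := X_ne_zero (R := ℂ) (0 : Fin 3) ((Ideal.mem_bot).mp
    (h (HomogeneousIdeal.mem_irrelevant_of_mem grading one_pos (isHomogeneous_X ℂ 0))))

theorem genericPoint_mem_chart (i : Fin 3) : genericPoint ∈ chart i := fun h =>
  X_ne_zero i ((Ideal.mem_bot).mp h)

theorem dvd_of_forall_exists_dvd_mul {f w : CoordRing} {d n : ℕ} (hf : f.IsHomogeneous d)
    (hw : w.IsHomogeneous n) (hf0 : f ≠ 0) (h : ∀ x : P2, ∃ c ∉ pointIdeal x, f ∣ c * w) :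
    f ∣ w := by
  let I : Ideal CoordRing := Submodule.comap (LinearMap.mulRight CoordRing w) (Ideal.span {f})
  have hI (c : CoordRing) : c ∈ I ↔ f ∣ c * w := Ideal.mem_span_singleton
  have hIhom : I.IsHomogeneous grading := fun k c hc => by
    obtain ⟨q, hq⟩ := (hI c).mp hc
    rw [coe_decompose_eq_homogeneousComponent, hI, ← Nat.add_sub_cancel k n,
      ← homogeneousComponent_mul_of_le hw (Nat.le_add_left n k), hq, mul_comm f]
    rcases le_or_gt d (k + n) with hle | hlt
    · rw [homogeneousComponent_mul_of_le hf hle]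
      exact dvd_mul_left _ _
    · rw [homogeneousComponent_mul_of_lt hf hlt]
      exact dvd_zero _
  have hX (i : Fin 3) : X i ∈ I.radical := by
    by_contra hi
    obtain ⟨x, hx⟩ := exists_le_pointIdeal hIhom hi
    obtain ⟨c, hc, hcw⟩ := h x
    exact hc (hx ((hI c).mpr hcw))
  choose n hn using hX
  have hprim : IsPrimitive fun i : Fin 3 => (X i : CoordRing) ^ n i :=
    isPrimitive_of_isRelPrime (i := 0) (j := 1) (isRelPrime_X_pow (by decide) _ _)
  exact hprim.dvd_of_forall_dvd_mul hf0 fun j => by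
    rw [mul_comm]
    exact (hI _).mp (hn j)

end Points

/-! ### Derivations of rational functions -/

section Derivations

theorem derivation_eq_of_forall_algebraMap {K A F : Type*} [CommRing K] [CommRing A] [Algebra K A]
    [Field F] [Algebra A F] [Algebra K F] [IsFractionRing A F] {D E : Derivation K F F}
    (h : ∀ a, D (algebraMap A F a) = E (algebraMap A F a)) : D = E := by
  ext z
  obtain ⟨a, c, -, rfl⟩ := IsFractionRing.div_surjective (A := A) z
  rw [Derivation.leibniz_div, Derivation.leibniz_div, h, h]

/-- A derivation of `F` that preserves a subalgebra `B`, restricted to `B`. -/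
def restrictDerivation {K B F : Type*} [CommRing K] [CommRing B] [Algebra K B] [CommRing F]
    [Algebra K F] (φ : B →ₐ[K] F) (hφ : Function.Injective φ) (δ : Derivation K F F)
    (h : ∀ s, ∃ r, φ r = δ (φ s)) : Derivation K B B :=
  let r (s : B) : B := (h s).choose
  have hr (s : B) : φ (r s) = δ (φ s) := (h s).choose_spec
  .mk' { toFun := r
         map_add' := fun s t => hφ <| by rw [hr, map_add φ (r s), hr, hr, map_add, map_add]
         map_smul' := fun c s => hφ <| by
          rw [hr, RingHom.id_apply, map_smul φ c (r s), hr, map_smul, Derivation.map_smul] }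
    fun s t => hφ <| by
      change φ (r (s * t)) = φ (s * r t + t * r s)
      rw [hr, map_add, map_mul φ s (r t), map_mul φ t (r s), hr, hr, map_mul, Derivation.leibniz,
        smul_eq_mul, smul_eq_mul]

theorem map_restrictDerivation {K B F : Type*} [CommRing K] [CommRing B] [Algebra K B]
    [CommRing F] [Algebra K F] (φ : B →ₐ[K] F) (hφ : Function.Injective φ) (δ : Derivation K F F)
    (h : ∀ s, ∃ r, φ r = δ (φ s)) (s : B) : φ (restrictDerivation φ hφ δ h s) = δ (φ s) :=
  (h s).choose_spec

section FractionField

variable {K A : Type*} (F : Type*) [CommRing K] [CommRing A] [Algebra K A]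
  [Field F] [Algebra A F] [Algebra K F] [IsScalarTower K A F] [IsFractionRing A F]

/-- The extension of a derivation by the quotient rule. -/
def extendToFractions (D : Derivation K A F) : Derivation K F F :=
  have := Algebra.FormallyEtale.of_isLocalization (Rₘ := F) (nonZeroDivisors A)
  (D.liftKaehlerDifferential.liftBaseChange F ∘ₗ
    (KaehlerDifferential.tensorKaehlerEquivOfFormallyEtale K A F).symm).compDer
      (KaehlerDifferential.D K F)

theorem extendToFractions_algebraMap (D : Derivation K A F) (a : A) :
    extendToFractions F D (algebraMap A F a) = D a := by
  have := Algebra.FormallyEtale.of_isLocalization (Rₘ := F) (nonZeroDivisors A)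
  simp [extendToFractions, KaehlerDifferential.tensorKaehlerEquivOfFormallyEtale_symm_D_algebraMap]

end FractionField

open MvPolynomial

variable {σ : Type*} (K F : Type*) [CommRing K] [Field F] [Algebra (MvPolynomial σ K) F]
  [Algebra K F] [IsScalarTower K (MvPolynomial σ K) F] [IsFractionRing (MvPolynomial σ K) F]

/-- The vector field `∑ vᵢ ∂ᵢ` on the rational functions, with rational coefficients `vᵢ`. -/
def rationalField : (σ → F) →ₗ[F] Derivation K F F where
  toFun v := extendToFractions F (mkDerivation K v)
  map_add' v w := derivation_eq_of_forall_algebraMap (A := MvPolynomial σ K) fun p => by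
    have : mkDerivation K (v + w) = mkDerivation K v + mkDerivation K w := by ext i; simp
    simp only [extendToFractions_algebraMap, Derivation.add_apply, this]
  map_smul' z v := derivation_eq_of_forall_algebraMap (A := MvPolynomial σ K) fun p => by
    have : mkDerivation K (z • v) = z • mkDerivation K v := by ext i; simp
    simp only [extendToFractions_algebraMap, Derivation.smul_apply, this, RingHom.id_apply]

theorem rationalField_algebraMap (v : σ → F) (p : MvPolynomial σ K) :
    rationalField K F v (algebraMap _ F p) = mkDerivation K v p :=
  extendToFractions_algebraMap F _ p

theorem mkDerivation_eq_sum {R τ : Type*} [CommSemiring R] [Fintype τ] (b : τ → MvPolynomial τ R)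
    (p : MvPolynomial τ R) : mkDerivation R b p = ∑ i, b i * pderiv i p := by
  classical
  let D : Derivation R (MvPolynomial τ R) (MvPolynomial τ R) := ∑ i, b i • pderiv i
  have hD (q : MvPolynomial τ R) : D q = ∑ i, b i * pderiv i q := by
    change Derivation.coeFnAddMonoidHom D q = _
    rw [map_sum, Finset.sum_apply]
    rfl
  have h : mkDerivation R b = D := derivation_ext fun j => by
    simp [hD, pderiv_X, Pi.single_apply]
  rw [h, hD]

theorem isHomogeneous_mkDerivation {R τ : Type*} [CommSemiring R] [Finite τ]
    {b : τ → MvPolynomial τ R} {m n : ℕ} (hb : ∀ i, (b i).IsHomogeneous (m + 1))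
    {p : MvPolynomial τ R} (hp : p.IsHomogeneous n) :
    (mkDerivation R b p).IsHomogeneous (m + n) := by
  have := Fintype.ofFinite τ
  rw [mkDerivation_eq_sum]
  refine IsHomogeneous.sum _ _ _ fun i _ => ?_
  obtain _ | n := n
  · rw [totalDegree_eq_zero_iff_eq_C.mp ((totalDegree_zero_iff_isHomogeneous _).mpr hp), pderiv_C,
      mul_zero]
    exact isHomogeneous_zero _ _ _
  · simpa only [add_assoc, add_tsub_cancel_right, add_comm 1 n] using
      (hb i).mul (hp.pderiv (i := i))

/-- The derivation `Xᵢ⁻ᵐ ∑ bⱼ ∂ⱼ` of the field of fractions. -/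
def chartDer (i : Fin 3) (m : ℕ) :
    (Fin 3 → CoordRing) →ₗ[CoordRing] Derivation ℂ FracField FracField :=
  (toFrac (X i) ^ m)⁻¹ • (rationalField ℂ FracField).restrictScalars CoordRing ∘ₗ
    (Algebra.linearMap CoordRing FracField).compLeft (Fin 3)

theorem chartDer_apply (i : Fin 3) (m : ℕ) (b : Fin 3 → CoordRing) :
    chartDer i m b = (toFrac (X i) ^ m)⁻¹ • rationalField ℂ FracField (toFrac ∘ b) := rfl

theorem chartDer_toFrac (i : Fin 3) (m : ℕ) (b : Fin 3 → CoordRing) (p : CoordRing) :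
    chartDer i m b (toFrac p) = toFrac (mkDerivation ℂ b p) / toFrac (X i) ^ m := by
  have h : mkDerivation ℂ (toFrac ∘ b) =
      (Algebra.linearMap CoordRing FracField).compDer (mkDerivation ℂ b) := by
    ext j
    simp
  rw [chartDer_apply, Derivation.smul_apply, rationalField_algebraMap, h, smul_eq_mul, mul_comm,
    div_eq_mul_inv]
  rfl

theorem chartDer_div (i : Fin 3) (m : ℕ) (b : Fin 3 → CoordRing) (a c : CoordRing) :
    chartDer i m b (toFrac a / toFrac c) =
      toFrac (mkDerivation ℂ b a * c - a * mkDerivation ℂ b c) / toFrac (X i ^ m * (c * c)) := by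
  rw [Derivation.leibniz_div, chartDer_toFrac, chartDer_toFrac]
  simp only [map_sub, map_mul, map_pow, smul_eq_mul]
  ring

theorem chartDer_change_chart (i j : Fin 3) (m : ℕ) (b : Fin 3 → CoordRing) :
    chartDer i m b = (toFrac (X j) / toFrac (X i)) ^ m • chartDer j m b := by
  rw [chartDer_apply, chartDer_apply, smul_smul, div_pow, div_mul_eq_mul_div,
    mul_inv_cancel₀ (pow_ne_zero m (toFrac_X_ne_zero j)), one_div]

theorem chartDer_ratio (i j : Fin 3) (m : ℕ) (b : Fin 3 → CoordRing) :
    toFrac (X i) ^ (m + 2) * chartDer i m b (toFrac (X j) / toFrac (X i)) =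
      toFrac (b j * X i - b i * X j) := by
  have := toFrac_X_ne_zero i
  rw [chartDer_div, mkDerivation_X, mkDerivation_X, mul_comm (X j)]
  simp only [map_mul, map_pow]
  field_simp
  ring

theorem isHomogeneous_chartDer_num {b : Fin 3 → CoordRing} {m n : ℕ}
    (hb : ∀ i, (b i).IsHomogeneous (m + 1)) {a c : CoordRing} (ha : a.IsHomogeneous n)
    (hc : c.IsHomogeneous n) :
    (mkDerivation ℂ b a * c - a * mkDerivation ℂ b c).IsHomogeneous (m + (n + n)) := by
  have h1 := (isHomogeneous_mkDerivation hb ha).mul hc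
  have h2 := ha.mul (isHomogeneous_mkDerivation hb hc)
  rw [add_assoc] at h1
  rw [add_left_comm] at h2
  exact h1.sub h2

theorem isHomogeneous_chartDer_den (i : Fin 3) (m : ℕ) {n : ℕ} {c : CoordRing}
    (hc : c.IsHomogeneous n) : (X i ^ m * (c * c)).IsHomogeneous (m + (n + n)) :=
  (isHomogeneous_X_pow i m).mul (hc.mul hc)

theorem exists_germToFrac_eq_chartDer {b : Fin 3 → CoordRing} {m : ℕ}
    (hb : ∀ i, (b i).IsHomogeneous (m + 1)) {i : Fin 3} {x : P2} (hx : x ∈ chart i)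
    (s : LocalRing x) : ∃ r, germToFrac x r = chartDer i m b (germToFrac x s) := by
  obtain ⟨n, a, c, ha, hc, hcx, h⟩ := exists_germToFrac_eq s
  rw [h, chartDer_div]
  exact exists_germ (isHomogeneous_chartDer_num hb ha hc) (isHomogeneous_chartDer_den i m hc)
    (mul_notMem (X_pow_notMem hx m) (mul_notMem hcx hcx))

/-- The derivation `Xᵢ⁻ᵐ ∑ bⱼ ∂ⱼ` of the local ring at a point with `Xᵢ ≠ 0`. -/
def germDer {b : Fin 3 → CoordRing} {m : ℕ} (hb : ∀ i, (b i).IsHomogeneous (m + 1)) {i : Fin 3}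
    {x : P2} (hx : x ∈ chart i) : Derivation ℂ (LocalRing x) (LocalRing x) :=
  restrictDerivation (germToFrac x) (germToFrac_injective x) (chartDer i m b)
    (exists_germToFrac_eq_chartDer hb hx)

theorem germToFrac_germDer {b : Fin 3 → CoordRing} {m : ℕ}
    (hb : ∀ i, (b i).IsHomogeneous (m + 1)) {i : Fin 3} {x : P2} (hx : x ∈ chart i)
    (s : LocalRing x) : germToFrac x (germDer hb hx s) = chartDer i m b (germToFrac x s) :=
  map_restrictDerivation _ _ _ _ s

theorem aeval_div_eq_aeval_div_pow {K F τ : Type*} [CommSemiring K] [Field F] [Algebra K F]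
    {n : ℕ} {a : MvPolynomial τ K} (ha : a.IsHomogeneous n) (v : τ → F) (t : F) :
    aeval (fun j => v j / t) a = aeval v a / t ^ n := by
  simp only [aeval_def, eval₂_eq, Finset.sum_div]
  refine Finset.sum_congr rfl fun s hs => ?_
  have hdeg : s.degree = n := not_not.mp (mt ha.coeff_eq_zero (mem_support_iff.mp hs))
  simp only [div_pow, Finset.prod_div_distrib, Finset.prod_pow_eq_pow_sum, mul_div_assoc, ← hdeg,
    Finsupp.degree_apply]

theorem germToFrac_aeval_ratio {n : ℕ} {a : CoordRing} (ha : a.IsHomogeneous n) {i : Fin 3}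
    {x : P2} (hx : x ∈ chart i) :
    germToFrac x (aeval (fun j => sectionAt (ratio i j) x hx) a) =
      toFrac a / toFrac (X i) ^ n := by
  have h : aeval (fun j => toFrac (X j)) a = toFrac a :=
    (aeval_unique (Algebra.algHom ℂ CoordRing FracField) ▸ rfl)
  rw [← h, ← aeval_div_eq_aeval_div_pow ha]
  simp only [← germToFrac_ratio _ hx]
  exact comp_aeval_apply _ (germToFrac x) a

theorem derivation_eq_of_forall_ratio {i : Fin 3} {x : P2} (hx : x ∈ chart i)
    {D E : Derivation ℂ (LocalRing x) (LocalRing x)}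
    (h : ∀ j, D (sectionAt (ratio i j) x hx) = E (sectionAt (ratio i j) x hx)) : D = E := by
  let φ : CoordRing →ₐ[ℂ] LocalRing x := aeval fun j => sectionAt (ratio i j) x hx
  have hφ (a : CoordRing) : D (φ a) = E (φ a) := by
    have : φ a ∈ Algebra.adjoin ℂ (Set.range fun j => sectionAt (ratio i j) x hx) := by
      rw [← aeval_range]
      exact ⟨a, rfl⟩
    exact Derivation.eqOn_adjoin (Set.forall_mem_range.mpr h) this
  refine Derivation.ext fun s => ?_
  obtain ⟨n, a, c, ha, hc, hcx, hs⟩ := exists_germToFrac_eq s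
  have hc0 := toFrac_ne_zero (ne_zero_of_notMem hcx)
  have hX := pow_ne_zero n (toFrac_X_ne_zero i)
  have hsφ : s * φ c = φ a := germToFrac_injective x <| by
    rw [map_mul, hs, germToFrac_aeval_ratio hc, germToFrac_aeval_ratio ha]
    field_simp
  have hφc : φ c ≠ 0 := fun h0 => div_ne_zero hc0 hX <| by
    rw [← germToFrac_aeval_ratio hc hx, h0, map_zero]
  have h1 : D (s * φ c) = E (s * φ c) := by rw [hsφ, hφ]
  rw [Derivation.leibniz, Derivation.leibniz, hφ] at h1
  exact mul_left_cancel₀ hφc (add_left_cancel h1)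

end Derivations

/-! ### Logarithmic vector fields attached to syzygies -/

section LogFields

open MvPolynomial

variable {f : CoordRing} {U V : P2.Opens} {m n k : ℕ} {b : Fin 3 → CoordRing} {i : Fin 3} {x : P2}

/-- The derivation of the local ring at `x` given by a section of the sheaf of logarithmic vector
fields. -/
def fieldAt (D : Γ(logTangentSheaf f, U)) (x : P2) (hx : x ∈ U) :
    Derivation ℂ (LocalRing x) (LocalRing x) :=
  (show logFields f U from D).1 ⟨x, hx⟩

theorem fieldAt_ext {D E : Γ(logTangentSheaf f, U)} (h : ∀ x hx, fieldAt D x hx = fieldAt E x hx) :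
    D = E :=
  Subtype.ext (funext fun x => h x.1 x.2 :
    (show logFields f U from D).1 = (show logFields f U from E).1)

theorem isLogField_fieldAt (D : Γ(logTangentSheaf f, U)) :
    IsLogField f U (fun x => fieldAt D x.1 x.2) :=
  (show logFields f U from D).2

theorem fieldAt_add (D E : Γ(logTangentSheaf f, U)) (hx : x ∈ U) :
    fieldAt (D + E) x hx = fieldAt D x hx + fieldAt E x hx := rfl

theorem fieldAt_smul (r : Γ(P2, U)) (D : Γ(logTangentSheaf f, U)) (hx : x ∈ U) :
    fieldAt (r • D) x hx = sectionAt r x hx • fieldAt D x hx := rfl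

theorem fieldAt_complex_smul (c : ℂ) (D : Γ(logTangentSheaf f, U)) (hx : x ∈ U) :
    fieldAt (c • D) x hx = c • fieldAt D x hx :=
  Derivation.ext fun s => (Algebra.smul_def c (fieldAt D x hx s)).symm

theorem fieldAt_res (h : V ≤ U) (D : Γ(logTangentSheaf f, U)) (hx : x ∈ V) :
    fieldAt (res (logTangentSheaf f) h D) x hx = fieldAt D x (h hx) := rfl

theorem mem_twistedSections_iff (F : Subsheaf (logTangentSheaf f))
    {s : ∀ i, Γ(logTangentSheaf f, chart i)} :
    s ∈ F.twistedSections m ↔ (∀ i, s i ∈ F.sections (chart i)) ∧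
      ∀ i j (x : P2) (hi : x ∈ chart i) (hj : x ∈ chart j),
        fieldAt (s i) x hi = sectionAt (ratio i j) x hi ^ m • fieldAt (s j) x hj := by
  refine and_congr_right fun _ => forall₂_congr fun i j => ?_
  exact ⟨fun h x hi hj => congrArg (fieldAt · x (⟨hi, hj⟩ : x ∈ chart i ⊓ chart j)) h,
    fun h => fieldAt_ext fun x hx => h x hx.1 hx.2⟩

/-- The syzygies of degree `n` of the partial derivatives of `f`. -/
abbrev jacobianSyzygies (f : CoordRing) (n : ℕ) : Submodule ℂ (Fin 3 → CoordRing) :=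
  syzygies (fun i => pderiv i f) n

theorem exists_section_germDer (hb : ∀ i, (b i).IsHomogeneous (m + 1)) (hV : V ≤ chart i)
    (s : Γ(P2, V)) :
    ∃ t : Γ(P2, V), ∀ x hx, sectionAt t x hx = germDer hb (hV hx) (sectionAt s x hx) := by
  refine exists_section _ fun x hx => ?_
  obtain ⟨W, hW, n, a, c, hx, ha, hc, h⟩ := exists_local_fraction s hx
  refine ⟨W, hW, _, _, _, hx, isHomogeneous_chartDer_num hb ha hc,
    isHomogeneous_chartDer_den i m hc, fun y hy hyV => ?_⟩
  obtain ⟨hcy, hs⟩ := h y hy hyV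
  exact ⟨mul_notMem (X_pow_notMem (hV hyV) m) (mul_notMem hcy hcy), by
    rw [germToFrac_germDer, hs, chartDer_div]⟩

theorem germDer_mem_curveIdeal (hb : b ∈ jacobianSyzygies f (m + 1)) (hx : x ∈ chart i)
    {s : LocalRing x} (hs : s ∈ curveIdeal f x) : germDer hb.1 hx s ∈ curveIdeal f x := by
  obtain ⟨p, c, hc, h⟩ := mem_curveIdeal.mp hs
  have h0 : chartDer i m b (toFrac f) = 0 := by
    rw [chartDer_toFrac, mkDerivation_eq_sum, hb.2, map_zero, zero_div]
  refine mem_curveIdeal.mpr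
    ⟨mkDerivation ℂ b p * c - p * mkDerivation ℂ b c, X i ^ m * (c * c),
      mul_notMem (X_pow_notMem hx m) (mul_notMem hc hc), ?_⟩
  rw [germToFrac_germDer, h, Derivation.leibniz, h0, smul_zero, add_zero, chartDer_div, smul_eq_mul]

/-- The logarithmic vector field `Xᵢ⁻ᵐ ∑ bⱼ ∂ⱼ` on the chart `Xᵢ ≠ 0` attached to a syzygy `b` of
degree `m + 1`. -/
def chartField (hb : b ∈ jacobianSyzygies f (m + 1)) (i : Fin 3) : Γ(logTangentSheaf f, chart i) :=
  show logFields f (chart i) from ⟨fun x => germDer hb.1 x.2, fun _ hV s =>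
    (exists_section_germDer hb.1 hV s).imp fun _ h x => h x.1 x.2,
    fun x _ hs => germDer_mem_curveIdeal hb x.2 hs⟩

theorem fieldAt_chartField (hb : b ∈ jacobianSyzygies f (m + 1)) (hx : x ∈ chart i) :
    fieldAt (chartField hb i) x hx = germDer hb.1 hx := rfl

theorem germDer_eq_smul_germDer {c : Fin 3 → CoordRing} (hb : ∀ i, (b i).IsHomogeneous (m + 1))
    (hc : ∀ i, (c i).IsHomogeneous (n + 1)) {j : Fin 3} (hi : x ∈ chart i) (hj : x ∈ chart j)
    {r : LocalRing x} (h : chartDer i m b = germToFrac x r • chartDer j n c) :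
    germDer hb hi = r • germDer hc hj :=
  Derivation.ext fun s => germToFrac_injective x <| by
    rw [Derivation.smul_apply, smul_eq_mul, map_mul, germToFrac_germDer, germToFrac_germDer, h,
      Derivation.smul_apply, smul_eq_mul]

theorem chartField_mem_twistedSections (hb : b ∈ jacobianSyzygies f (m + 1))
    (F : Subsheaf (logTangentSheaf f)) :
    chartField hb ∈ F.twistedSections m ↔ ∀ i, chartField hb i ∈ F.sections (chart i) := by
  rw [mem_twistedSections_iff]
  refine and_iff_left fun i j x hi hj => germDer_eq_smul_germDer hb.1 hb.1 hi hj ?_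
  rw [map_pow, germToFrac_ratio, ← chartDer_change_chart]

/-- The vector fields attached to syzygies of degree `m + 1`. -/
def chartFields (f : CoordRing) (m : ℕ) :
    jacobianSyzygies f (m + 1) →ₗ[ℂ] ∀ i, Γ(logTangentSheaf f, chart i) where
  toFun b := chartField b.2
  map_add' a b := funext fun i => fieldAt_ext fun x hx => Derivation.ext fun s =>
    germToFrac_injective x <| by
      simp only [Pi.add_apply, fieldAt_add, fieldAt_chartField, Derivation.add_apply, map_add,
        germToFrac_germDer, Submodule.coe_add]
  map_smul' c b := funext fun i => fieldAt_ext fun x hx => Derivation.ext fun s =>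
    germToFrac_injective x <| by
      simp only [Pi.smul_apply, fieldAt_complex_smul, fieldAt_chartField, Derivation.smul_apply,
        map_smul, germToFrac_germDer, Submodule.coe_smul, LinearMap.map_smul_of_tower,
        RingHom.id_apply]

theorem exists_chartField_smul_eq (hb : b ∈ jacobianSyzygies f (m + 1)) {h : CoordRing}
    (hh : h.IsHomogeneous k) (hhb : h • b ∈ jacobianSyzygies f (m + k + 1)) (i : Fin 3) :
    ∃ r : Γ(P2, chart i), chartField hhb i = r • chartField hb i := by
  obtain ⟨r, hr⟩ := exists_section_of_fraction hh (isHomogeneous_X_pow i k)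
    fun x hx => X_pow_notMem hx k
  refine ⟨r, fieldAt_ext fun x hx =>
    germDer_eq_smul_germDer hhb.1 hb.1 hx hx (r := sectionAt r x hx) ?_⟩
  have := toFrac_X_ne_zero i
  rw [hr, map_smul, chartDer_apply, chartDer_apply, ← algebraMap_smul FracField h, smul_smul,
    smul_smul, map_pow]
  congr 1
  field_simp
  ring

theorem smul_mem_jacobianSyzygies (hb : b ∈ jacobianSyzygies f n) {h : CoordRing}
    (hh : h.IsHomogeneous k) : h • b ∈ jacobianSyzygies f (n + k) := by
  refine ⟨fun i => ?_, ?_⟩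
  · rw [add_comm]
    exact hh.mul (hb.1 i)
  · simp only [Pi.smul_apply, smul_eq_mul, mul_assoc, ← Finset.mul_sum, hb.2, mul_zero]

end LogFields

/-! ### Twisted sections are syzygies -/

section TwistedSections

open MvPolynomial

variable {f : CoordRing} {d m n k : ℕ} {b : Fin 3 → CoordRing} {i j : Fin 3} {x : P2}

/-- The value of a vector field `D` on the ratio `Xⱼ / Xᵢ`, cleared of its expected denominator:
for `D = Xᵢ⁻ᵐ ∑ bₖ ∂ₖ` it is `bⱼ Xᵢ - bᵢ Xⱼ`. -/
def wedge (m : ℕ) (D : Γ(logTangentSheaf f, chart i)) (j : Fin 3) (x : P2) (hx : x ∈ chart i) :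
    FracField :=
  toFrac (X i) ^ (m + 2) * germToFrac x (fieldAt D x hx (sectionAt (ratio i j) x hx))

theorem fieldAt_eq_germDer_iff {D : Γ(logTangentSheaf f, chart i)} {hx : x ∈ chart i}
    (hb : ∀ i, (b i).IsHomogeneous (m + 1)) :
    fieldAt D x hx = germDer hb hx ↔ ∀ j, wedge m D j x hx = toFrac (b j * X i - b i * X j) := by
  have hvalue (j : Fin 3) : toFrac (X i) ^ (m + 2) *
      germToFrac x (germDer hb hx (sectionAt (ratio i j) x hx)) =
        toFrac (b j * X i - b i * X j) := by
    rw [germToFrac_germDer, germToFrac_ratio, chartDer_ratio]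
  refine ⟨fun h j => by rw [wedge, h, hvalue], fun h => derivation_eq_of_forall_ratio hx fun j =>
    germToFrac_injective x (mul_left_cancel₀ (pow_ne_zero (m + 2) (toFrac_X_ne_zero i)) ?_)⟩
  exact (h j).trans (hvalue j).symm

theorem exists_pow_mul_wedge_eq (m : ℕ) (D : Γ(logTangentSheaf f, chart i)) (j : Fin 3) :
    ∃ (n : ℕ) (u : CoordRing), u.IsHomogeneous (m + 2 + n) ∧
      ∀ x hx, toFrac (X i) ^ n * wedge m D j x hx = toFrac u := by
  obtain ⟨t, ht⟩ := (isLogField_fieldAt D).regular (chart i) le_rfl (ratio i j)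
  obtain ⟨n, u, hu, h⟩ := exists_chart_fraction t
  refine ⟨n, X i ^ (m + 2) * u, (isHomogeneous_X_pow i (m + 2)).mul hu, fun x hx => ?_⟩
  have hvalue : germToFrac x (fieldAt D x hx (sectionAt (ratio i j) x hx)) =
      toFrac u / toFrac (X i) ^ n :=
    (congrArg (germToFrac x) (ht ⟨x, hx⟩).symm).trans (h x hx)
  have := toFrac_X_ne_zero i
  rw [wedge, hvalue, map_mul, map_pow]
  field_simp

theorem wedge_eq_wedge (m : ℕ) (D : Γ(logTangentSheaf f, chart i)) (j : Fin 3) {y : P2}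
    (hx : x ∈ chart i) (hy : y ∈ chart i) : wedge m D j x hx = wedge m D j y hy := by
  obtain ⟨n, u, -, h⟩ := exists_pow_mul_wedge_eq m D j
  exact mul_left_cancel₀ (pow_ne_zero n (toFrac_X_ne_zero i)) ((h x hx).trans (h y hy).symm)

theorem X_mul_wedge {D : Γ(logTangentSheaf f, chart i)} {E : Γ(logTangentSheaf f, chart j)}
    {hi : x ∈ chart i} {hj : x ∈ chart j}
    (h : fieldAt D x hi = sectionAt (ratio i j) x hi ^ m • fieldAt E x hj) (k : Fin 3) :
    toFrac (X j) * wedge m D k x hi =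
      toFrac (X i) * wedge m E k x hj - toFrac (X k) * wedge m E i x hj := by
  have hXi := toFrac_X_ne_zero i
  have hXj := toFrac_X_ne_zero j
  have hratio : sectionAt (ratio j k) x hj =
      sectionAt (ratio i k) x hi * sectionAt (ratio j i) x hj := germToFrac_injective x <| by
    rw [map_mul, germToFrac_ratio, germToFrac_ratio, germToFrac_ratio]
    field_simp
  have hleibniz := congrArg (germToFrac x) ((fieldAt E x hj).leibniz
    (sectionAt (ratio i k) x hi) (sectionAt (ratio j i) x hj))
  rw [← hratio, smul_eq_mul, smul_eq_mul, map_add, map_mul, map_mul, germToFrac_ratio,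
    germToFrac_ratio] at hleibniz
  rw [wedge, wedge, wedge, h, Derivation.smul_apply, smul_eq_mul, map_mul, map_pow,
    germToFrac_ratio, div_pow, hleibniz]
  have := pow_ne_zero m hXi
  field_simp
  ring

theorem exists_toFrac_eq {F : FracField} {u v : CoordRing} (hij : i ≠ j)
    (hu : u.IsHomogeneous (m + n)) (hi : toFrac (X i) ^ n * F = toFrac u)
    (hj : toFrac (X j) ^ k * F = toFrac v) : ∃ q : CoordRing, q.IsHomogeneous m ∧ toFrac q = F := by
  have huv : X j ^ k * u = X i ^ n * v := toFrac_injective <| by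
    rw [map_mul, map_mul, map_pow, map_pow, ← hi, ← hj]
    ring
  obtain ⟨q, rfl⟩ := (isRelPrime_X_pow hij n k).dvd_of_dvd_mul_left (Dvd.intro _ huv.symm)
  refine ⟨q, isHomogeneous_of_mul_right (isHomogeneous_X_pow i n)
    (pow_ne_zero n (X_ne_zero i)) (mul_comm q _ ▸ hu), ?_⟩
  refine mul_left_cancel₀ (pow_ne_zero n (toFrac_X_ne_zero i)) ?_
  rw [hi, map_mul, map_pow]

theorem exists_eq_sub_of_cyclic_sum {Q : Fin 3 → Fin 3 → CoordRing}
    (hQ : ∀ i j, (Q i j).IsHomogeneous (m + 2)) (h0 : Q 0 0 = 0) (hanti : Q 2 0 = -Q 0 2)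
    (h : Q 1 2 * X 0 + Q 2 0 * X 1 + Q 0 1 * X 2 = 0) :
    ∃ b : Fin 3 → CoordRing, (∀ i, (b i).IsHomogeneous (m + 1)) ∧
      ∀ k, Q 0 k = b k * X 0 - b 0 * X k := by
  obtain ⟨c, hc⟩ := exists_eq_cross_of_X_pow_mem_span (n := 1) (F := X)
    (a := ![Q 1 2, Q 2 0, Q 0 1]) (fun i => by
      rw [pow_one]
      exact Ideal.subset_span (Set.mem_range_self i))
    (by simpa only [Matrix.vec3_dotProduct, Matrix.cons_val] using h)
  obtain ⟨-, h1, h2⟩ := eq_cross_iff.mp hc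
  simp only [Matrix.cons_val] at h1 h2
  have hX (k : Fin 3) : Q 0 k = -c k * X 0 - -c 0 * X k := by
    fin_cases k
    · simp only [Fin.zero_eta, h0, sub_self]
    · simp only [Fin.mk_one]
      linear_combination h2
    · simp only [Fin.reduceFinMk]
      linear_combination -h1 + hanti
  refine ⟨fun i => homogeneousComponent (m + 1) (-c i),
    fun i => homogeneousComponent_isHomogeneous _ _, fun k => ?_⟩
  conv_lhs => rw [← homogeneousComponent_eq_self (hQ 0 k), hX, map_sub]
  rw [homogeneousComponent_mul_of_le (isHomogeneous_X ℂ 0) (by omega),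
    homogeneousComponent_mul_of_le (isHomogeneous_X ℂ k) (by omega)]
  rfl

theorem exists_form_of_cocycle {T : Fin 3 → Fin 3 → FracField}
    (hT : ∀ i j, ∃ (n : ℕ) (u : CoordRing), u.IsHomogeneous (m + 2 + n) ∧
      toFrac (X i) ^ n * T i j = toFrac u)
    (h : ∀ i j k, toFrac (X j) * T i k = toFrac (X i) * T j k - toFrac (X k) * T j i) :
    ∃ b : Fin 3 → CoordRing, (∀ i, (b i).IsHomogeneous (m + 1)) ∧
      ∀ i j, T i j = toFrac (b j * X i - b i * X j) := by
  have hX := toFrac_X_ne_zero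
  have h0 (i : Fin 3) : T i i = 0 :=
    (mul_eq_zero.mp ((h i i i).trans (sub_self _))).resolve_left (hX i)
  have hanti (i j : Fin 3) : T i j = -T j i := mul_left_cancel₀ (hX j) <| by
    rw [h i j j, h0, mul_zero, zero_sub, mul_neg]
  have hpoly (i j : Fin 3) : ∃ q : CoordRing, q.IsHomogeneous (m + 2) ∧ toFrac q = T i j := by
    obtain rfl | hij := eq_or_ne i j
    · exact ⟨0, isHomogeneous_zero _ _ _, by rw [h0, map_zero]⟩
    · obtain ⟨n, u, hu, hun⟩ := hT i j
      obtain ⟨k, v, -, hvk⟩ := hT j i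
      exact exists_toFrac_eq (v := -v) hij hu hun (by rw [hanti, mul_neg, hvk, map_neg])
  choose Q hQ hQT using hpoly
  obtain ⟨b, hb, hQb⟩ := exists_eq_sub_of_cyclic_sum hQ
    (toFrac_injective (by rw [hQT, h0, map_zero]))
    (toFrac_injective (by rw [map_neg, hQT, hQT, hanti]))
    (toFrac_injective (by
      simp only [map_add, map_mul, map_zero, hQT]
      linear_combination -h 0 1 2 + toFrac (X 1) * hanti 0 2 + toFrac (X 2) * hanti 0 1))
  have hb0 (k : Fin 3) : T 0 k = toFrac (b k * X 0 - b 0 * X k) := by rw [← hQb, hQT]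
  refine ⟨b, hb, fun i j => mul_left_cancel₀ (hX 0) ?_⟩
  rw [h i 0 j, hb0, hb0]
  simp only [map_sub, map_mul]
  ring

theorem exists_form_of_twistedSections {s : ∀ i, Γ(logTangentSheaf f, chart i)}
    (hs : s ∈ (Subsheaf.whole (logTangentSheaf f)).twistedSections m) :
    ∃ (b : Fin 3 → CoordRing) (hb : ∀ i, (b i).IsHomogeneous (m + 1)),
      ∀ i x (hx : x ∈ chart i), fieldAt (s i) x hx = germDer hb hx := by
  have hglue := ((mem_twistedSections_iff _).mp hs).2
  obtain ⟨b, hb, h⟩ := exists_form_of_cocycle (m := m)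
    (T := fun i j => wedge m (s i) j genericPoint (genericPoint_mem_chart i))
    (fun i j => (exists_pow_mul_wedge_eq m (s i) j).imp fun n => Exists.imp fun u hu =>
      ⟨hu.1, hu.2 genericPoint (genericPoint_mem_chart i)⟩)
    (fun i j k => X_mul_wedge (hglue i j genericPoint _ _) k)
  exact ⟨b, hb, fun i x hx => (fieldAt_eq_germDer_iff hb).mpr fun j =>
    (wedge_eq_wedge m (s i) j hx _).trans (h i j)⟩

theorem dvd_mkDerivation (hhom : f.IsHomogeneous d) (hf0 : f ≠ 0)
    (hb : ∀ i, (b i).IsHomogeneous (m + 1))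
    (h : ∀ i x (hx : x ∈ chart i), ∀ s ∈ curveIdeal f x, germDer hb hx s ∈ curveIdeal f x) :
    f ∣ mkDerivation ℂ b f := by
  refine dvd_of_forall_exists_dvd_mul hhom (isHomogeneous_mkDerivation hb hhom) hf0 fun x => ?_
  obtain ⟨i, hi⟩ := exists_mem_chart x
  have hXd := X_pow_notMem hi d
  obtain ⟨s, hs⟩ := exists_germ hhom (isHomogeneous_X_pow i d) hXd
  have hsI : s ∈ curveIdeal f x := mem_curveIdeal.mpr ⟨1, X i ^ d, hXd, by
    rw [hs, map_one, mul_one_div]⟩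
  obtain ⟨p, c, hc, hpc⟩ := mem_curveIdeal.mp (h i x hi s hsI)
  rw [germToFrac_germDer, hs, chartDer_div] at hpc
  refine ⟨c * X i ^ d, mul_notMem hc hXd, ?_⟩
  have hc0 := toFrac_ne_zero (ne_zero_of_notMem hc)
  have hden := toFrac_ne_zero
    (ne_zero_of_notMem (mul_notMem (X_pow_notMem hi m) (mul_notMem hXd hXd)))
  have hdiv : (mkDerivation ℂ b f * X i ^ d - f * mkDerivation ℂ b (X i ^ d)) * c =
      f * p * (X i ^ m * (X i ^ d * X i ^ d)) := toFrac_injective <| by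
    rw [map_mul, (div_eq_iff hden).mp hpc, map_mul toFrac (f * p), map_mul toFrac f]
    field_simp
  exact ⟨p * (X i ^ m * (X i ^ d * X i ^ d)) + mkDerivation ℂ b (X i ^ d) * c, by
    linear_combination hdiv⟩

theorem exists_sub_smul_X_mem_jacobianSyzygies (hd : d ≠ 0) (hhom : f.IsHomogeneous d)
    (hf0 : f ≠ 0) (hb : ∀ i, (b i).IsHomogeneous (m + 1)) (h : f ∣ mkDerivation ℂ b f) :
    ∃ w : CoordRing, b - w • X ∈ jacobianSyzygies f (m + 1) := by
  obtain ⟨h, hh⟩ := h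
  have hhm : h.IsHomogeneous m := isHomogeneous_of_mul_right hhom hf0 <| by
    rw [mul_comm, ← hh]
    exact isHomogeneous_mkDerivation hb hhom
  have heuler : ∑ i, X i * pderiv i f = (d : CoordRing) * f :=
    hhom.sum_X_mul_pderiv.trans (nsmul_eq_mul d f)
  have hinv : C (d : ℂ)⁻¹ * (d : CoordRing) = 1 := by
    rw [← map_natCast (C (σ := Fin 3) (R := ℂ)), ← C_mul, inv_mul_cancel₀ (Nat.cast_ne_zero.mpr hd),
      C_1]
  refine ⟨C (d : ℂ)⁻¹ * h, fun i => (hb i).sub ((hhm.C_mul _).mul (isHomogeneous_X ℂ i)), ?_⟩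
  rw [mkDerivation_eq_sum] at hh
  simp only [Pi.sub_apply, Pi.smul_apply, smul_eq_mul, sub_mul, Finset.sum_sub_distrib, hh,
    mul_assoc, ← Finset.mul_sum, heuler]
  linear_combination -(f * h) * hinv

theorem exists_syzygy_of_twistedSections (hd : d ≠ 0) (hhom : f.IsHomogeneous d) (hf0 : f ≠ 0)
    {s : ∀ i, Γ(logTangentSheaf f, chart i)}
    (hs : s ∈ (Subsheaf.whole (logTangentSheaf f)).twistedSections m) :
    ∃ b, chartFields f m b = s := by
  obtain ⟨b, hb, hsb⟩ := exists_form_of_twistedSections hs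
  have hdvd : f ∣ mkDerivation ℂ b f := dvd_mkDerivation hhom hf0 hb fun i x hx t ht => by
    rw [← hsb i x hx]
    exact (isLogField_fieldAt (s i)).preserves ⟨x, hx⟩ t ht
  obtain ⟨w, hw⟩ := exists_sub_smul_X_mem_jacobianSyzygies hd hhom hf0 hb hdvd
  refine ⟨⟨_, hw⟩, funext fun i => fieldAt_ext fun x hx => Eq.symm ?_⟩
  refine (fieldAt_eq_germDer_iff hw.1).mpr fun j => ?_
  rw [(fieldAt_eq_germDer_iff hb).mp (hsb i x hx)]
  simp only [Pi.sub_apply, Pi.smul_apply, smul_eq_mul]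
  congr 1
  ring

theorem eq_zero_of_proportional_X (hd : d ≠ 0) (hhom : f.IsHomogeneous d) (hf0 : f ≠ 0)
    (hb : ∑ j, b j * pderiv j f = 0) (h : ∀ j, b j * X i = b i * X j) : b = 0 := by
  have hbi : b i = 0 := by
    have heuler : b i * (d • f) = 0 := by
      calc b i * (d • f) = ∑ j, b i * X j * pderiv j f := by
            simp only [← hhom.sum_X_mul_pderiv, Finset.mul_sum, mul_assoc]
        _ = (∑ j, b j * pderiv j f) * X i := by
            simp only [← h, Finset.sum_mul, mul_right_comm]
        _ = 0 := by rw [hb, zero_mul]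
    exact (mul_eq_zero.mp heuler).resolve_right (smul_ne_zero hd hf0)
  refine funext fun j => (mul_eq_zero.mp ?_).resolve_right (X_ne_zero i)
  rw [h, hbi, zero_mul]

theorem chartFields_injective (hd : d ≠ 0) (hhom : f.IsHomogeneous d) (hf0 : f ≠ 0) (m : ℕ) :
    Function.Injective (chartFields f m) := by
  rw [injective_iff_map_eq_zero]
  rintro ⟨b, hb⟩ h
  refine Subtype.ext (eq_zero_of_proportional_X (i := 0) hd hhom hf0 hb.2 fun j => ?_)
  have hzero := (fieldAt_eq_germDer_iff hb.1).mp
    (fieldAt_chartField hb (genericPoint_mem_chart 0)) j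
  rw [show chartField hb 0 = 0 from congrFun h 0, wedge] at hzero
  refine sub_eq_zero.mp (toFrac_injective (hzero.symm.trans ?_))
  rw [map_zero]
  exact mul_eq_zero_of_right _ (map_zero (germToFrac genericPoint))

/-- The syzygies of degree `m + 1` that correspond to the global sections of the `m`-th twist of a
subsheaf of the sheaf of logarithmic vector fields. -/
def formSections (F : Subsheaf (logTangentSheaf f)) (m : ℕ) : Submodule ℂ (Fin 3 → CoordRing) :=
  ((F.twistedSections m).comap (chartFields f m)).map (jacobianSyzygies f (m + 1)).subtype

theorem mem_formSections {F : Subsheaf (logTangentSheaf f)} :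
    b ∈ formSections F m ↔
      ∃ hb : b ∈ jacobianSyzygies f (m + 1), ∀ i, chartField hb i ∈ F.sections (chart i) := by
  constructor
  · rintro ⟨b, hb, rfl⟩
    exact ⟨b.2, (chartField_mem_twistedSections b.2 F).mp hb⟩
  · rintro ⟨hb, h⟩
    exact ⟨⟨b, hb⟩, (chartField_mem_twistedSections hb F).mpr h, rfl⟩

theorem formSections_le (F : Subsheaf (logTangentSheaf f)) (m : ℕ) :
    formSections F m ≤ jacobianSyzygies f (m + 1) := fun _ hb => (mem_formSections.mp hb).1

theorem formSections_whole (f : CoordRing) (m : ℕ) :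
    formSections (Subsheaf.whole (logTangentSheaf f)) m = jacobianSyzygies f (m + 1) :=
  le_antisymm (formSections_le _ m) fun _ hb => mem_formSections.mpr ⟨hb, fun _ => trivial⟩

theorem nonempty_formSections_equiv (hd : d ≠ 0) (hhom : f.IsHomogeneous d) (hf0 : f ≠ 0)
    (F : Subsheaf (logTangentSheaf f)) (m : ℕ) :
    Nonempty (formSections F m ≃ₗ[ℂ] F.twistedSections m) := by
  have hmap : ((F.twistedSections m).comap (chartFields f m)).map (chartFields f m) =
      F.twistedSections m := Submodule.map_comap_eq_of_le fun s hs =>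
    exists_syzygy_of_twistedSections hd hhom hf0 ⟨fun _ => trivial, hs.2⟩
  exact ⟨(Submodule.equivMapOfInjective _ (Submodule.injective_subtype _) _).symm.trans
    ((Submodule.equivMapOfInjective _ (chartFields_injective hd hhom hf0 m) _).trans
      (LinearEquiv.ofEq _ _ hmap))⟩

theorem smul_mem_formSections {F : Subsheaf (logTangentSheaf f)} (hb : b ∈ formSections F m)
    {h : CoordRing} (hh : h.IsHomogeneous k) : h • b ∈ formSections F (m + k) := by
  obtain ⟨hb, hF⟩ := mem_formSections.mp hb
  have hhb : h • b ∈ jacobianSyzygies f (m + k + 1) :=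
    add_right_comm m 1 k ▸ smul_mem_jacobianSyzygies hb hh
  refine mem_formSections.mpr ⟨hhb, fun i => ?_⟩
  obtain ⟨r, hr⟩ := exists_chartField_smul_eq hb hh hhb i
  rw [hr]
  exact Submodule.smul_mem _ _ (hF i)

end TwistedSections

/-! ### Hilbert polynomials -/

section PrimitiveFactor

open MvPolynomial

theorem coe_order_le_totalDegree {σ R : Type*} [CommSemiring R] {p : MvPolynomial σ R}
    (hp : p ≠ 0) : (p : MvPowerSeries σ R).order ≤ p.totalDegree := by
  obtain ⟨s, hs⟩ := support_nonempty.mpr hp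
  exact (MvPowerSeries.order_le ((coeff_coe p s).trans_ne (mem_support_iff.mp hs))).trans
    (Nat.cast_le.mpr (le_totalDegree hs))

theorem isHomogeneous_totalDegree_of_mul {σ R : Type*} [CommRing R] [IsDomain R]
    {p q : MvPolynomial σ R} {n : ℕ} (h : (p * q).IsHomogeneous n) (h0 : p * q ≠ 0) :
    p.IsHomogeneous p.totalDegree := by
  have hp0 := left_ne_zero_of_mul h0
  have hq0 := right_ne_zero_of_mul h0
  have hn : p.totalDegree + q.totalDegree = n := by
    rw [← totalDegree_mul_of_isDomain hp0 hq0, h.totalDegree h0]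
  have horder : (n : ℕ∞) ≤ (p : MvPowerSeries σ R).order + (q : MvPowerSeries σ R).order := by
    rw [← MvPowerSeries.order_mul, ← coe_mul]
    refine MvPowerSeries.le_order fun s hs => ?_
    exact (coeff_coe (p * q) s).trans (h.coeff_eq_zero (Nat.cast_lt.mp hs).ne)
  have hle : (p.totalDegree : ℕ∞) ≤ (p : MvPowerSeries σ R).order := by
    rw [← hn, Nat.cast_add] at horder
    exact (ENat.add_le_add_iff_right (ENat.natCast_ne_top q.totalDegree)).mp
      (horder.trans (add_le_add_right (coe_order_le_totalDegree hq0) _))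
  intro s hs
  refine (DFunLike.congr_fun Finsupp.degree_eq_weight_one s).symm.trans ?_
  refine le_antisymm (le_totalDegree (mem_support_iff.mpr hs)) ((Nat.cast_le (α := ℕ∞)).mp ?_)
  exact hle.trans (MvPowerSeries.order_le ((coeff_coe p s).trans_ne hs))

theorem exists_eq_smul_isPrimitive {R ι : Type*} [CommRing R] [IsDomain R]
    [UniqueFactorizationMonoid R] [Finite ι] {b : ι → R} (hb : b ≠ 0) :
    ∃ (g : R) (a : ι → R), b = g • a ∧ IsPrimitive a := by
  classical
  cases nonempty_fintype ι
  let _ : StrongNormalizationMonoid R := UniqueFactorizationMonoid.strongNormalizationMonoid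
  let _ : NormalizedGCDMonoid R := UniqueFactorizationMonoid.toNormalizedGCDMonoid R
  obtain ⟨i, -⟩ := Function.ne_iff.mp hb
  obtain ⟨a, ha, hgcd⟩ := Finset.extract_gcd b ⟨i, Finset.mem_univ i⟩
  refine ⟨Finset.univ.gcd b, a, funext fun j => ha j (Finset.mem_univ j), fun p hp => ?_⟩
  by_contra! h
  exact hp.not_isUnit (isUnit_of_dvd_one (hgcd ▸ Finset.dvd_gcd fun j _ => h j))

theorem exists_isPrimitive_mem_syzygies {σ ι K : Type*} [Fintype ι] [Field K]
    {F b : ι → MvPolynomial σ K} {n : ℕ} (hb : b ∈ syzygies F n) (hb0 : b ≠ 0) :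
    ∃ k ≤ n, ∃ (g : MvPolynomial σ K) (a : ι → MvPolynomial σ K),
      b = g • a ∧ a ≠ 0 ∧ IsPrimitive a ∧ a ∈ syzygies F k := by
  obtain ⟨g, a, rfl, ha⟩ := exists_eq_smul_isPrimitive hb0
  obtain ⟨i, hi⟩ := Function.ne_iff.mp hb0
  have hg0 : g ≠ 0 := left_ne_zero_of_mul hi
  have hg := isHomogeneous_totalDegree_of_mul (hb.1 i) hi
  have hgn : g.totalDegree ≤ n := by
    rw [← (hb.1 i).totalDegree hi]
    exact totalDegree_le_of_dvd_of_isDomain (dvd_mul_right g (a i)) hi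
  refine ⟨n - g.totalDegree, Nat.sub_le _ _, g, a, rfl, right_ne_zero_of_smul hb0, ha,
    fun j => ?_, ?_⟩
  · refine isHomogeneous_of_mul_right hg hg0 ?_
    rw [Nat.sub_add_cancel hgn, mul_comm]
    exact hb.1 j
  · refine (mul_eq_zero.mp ?_).resolve_left hg0
    simpa only [Pi.smul_apply, smul_eq_mul, mul_assoc, ← Finset.mul_sum] using hb.2

end PrimitiveFactor

section Growth

open Polynomial Filter

variable {q r : ℚ[X]}

theorem leadingCoeff_nonneg_of_eventually (h : ∀ᶠ m : ℕ in atTop, 0 ≤ q.eval (m : ℚ)) :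
    0 ≤ q.leadingCoeff := by
  by_contra! hneg
  rcases le_or_gt q.degree 0 with hdeg | hdeg
  · rw [eq_C_of_degree_le_zero hdeg] at h hneg
    obtain ⟨m, hm⟩ := h.exists
    rw [eval_C] at hm
    rw [leadingCoeff_C] at hneg
    exact hm.not_gt hneg
  · have htendsto := (q.tendsto_atBot_of_leadingCoeff_nonpos hdeg hneg.le).comp
      (tendsto_natCast_atTop_atTop (R := ℚ))
    obtain ⟨m, hm, hm'⟩ := (h.and (htendsto.eventually_lt_atBot 0)).exists
    exact hm.not_gt hm'

theorem coeff_nonneg_of_eventually {n : ℕ} (hq : q.natDegree ≤ n)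
    (h : ∀ᶠ m : ℕ in atTop, 0 ≤ q.eval (m : ℚ)) : 0 ≤ q.coeff n := by
  rcases hq.eq_or_lt with rfl | hlt
  · exact leadingCoeff_nonneg_of_eventually h
  · exact (coeff_eq_zero_of_natDegree_lt hlt).ge

theorem coeff_le_of_eventually {n : ℕ} (hqr : (r - q).natDegree ≤ n)
    (h : ∀ᶠ m : ℕ in atTop, q.eval (m : ℚ) ≤ r.eval (m : ℚ)) : q.coeff n ≤ r.coeff n := by
  rw [← sub_nonneg, ← coeff_sub]
  exact coeff_nonneg_of_eventually hqr (h.mono fun m hm => by rwa [eval_sub, sub_nonneg])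

theorem natDegree_le_of_eventually (h0 : ∀ᶠ m : ℕ in atTop, 0 ≤ q.eval (m : ℚ))
    (h : ∀ᶠ m : ℕ in atTop, q.eval (m : ℚ) ≤ r.eval (m : ℚ)) : q.natDegree ≤ r.natDegree := by
  by_contra! hlt
  have hle := coeff_le_of_eventually ((natDegree_sub_le r q).trans (max_le hlt.le le_rfl)) h
  rw [coeff_eq_zero_of_natDegree_lt hlt] at hle
  have hq := le_antisymm hle (leadingCoeff_nonneg_of_eventually h0)
  rw [coeff_natDegree, leadingCoeff_eq_zero] at hq
  rw [hq, natDegree_zero] at hlt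
  exact absurd hlt (Nat.not_lt_zero _)

theorem eq_of_eventually_eval_eq (h : ∀ᶠ m : ℕ in atTop, q.eval (m : ℚ) = r.eval (m : ℚ)) :
    q = r := by
  obtain ⟨N, hN⟩ := eventually_atTop.mp h
  refine eq_of_infinite_eval_eq q r (Set.Infinite.mono (s := Nat.cast '' Set.Ici N) ?_
    ((Set.Ici_infinite N).image Nat.cast_injective.injOn))
  rintro _ ⟨m, hm, rfl⟩
  exact hN m hm

/-- The Hilbert polynomial of `𝒪(c)` on the plane. -/
def twistPoly (c : ℚ) : ℚ[X] :=
  C (1 / 2) * X ^ 2 + C (c + 3 / 2) * X + C ((c + 2) * (c + 1) / 2)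

theorem coeff_two_twistPoly (c : ℚ) : (twistPoly c).coeff 2 = 1 / 2 := by
  simp [twistPoly]

theorem coeff_one_twistPoly (c : ℚ) : (twistPoly c).coeff 1 = c + 3 / 2 := by
  simp [twistPoly, coeff_C, coeff_X_pow]

theorem natDegree_twistPoly_le (c : ℚ) : (twistPoly c).natDegree ≤ 2 := by
  unfold twistPoly
  compute_degree

theorem eval_twistPoly {c : ℚ} {m n : ℕ} (h : (n : ℚ) = m + c) :
    (twistPoly c).eval (m : ℚ) = ((n + 2).choose 2 : ℕ) := by
  rw [Nat.cast_choose_two]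
  simp only [twistPoly, eval_add, eval_mul, eval_C, eval_pow, eval_X]
  push_cast
  rw [h]
  ring

theorem rank_twistPoly (c : ℚ) : rank (twistPoly c) = 1 := by
  rw [rank, coeff_two_twistPoly]
  norm_num

theorem slope_twistPoly (c : ℚ) : slope (twistPoly c) = c := by
  rw [slope, degree, rank_twistPoly, coeff_one_twistPoly]
  ring

end Growth

section Multiples

open MvPolynomial

variable {σ ι K : Type*} [Field K]

/-- The multiples of a vector `a` of polynomials by the forms of degree `n`. -/
def multiples (a : ι → MvPolynomial σ K) (n : ℕ) : Submodule K (ι → MvPolynomial σ K) :=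
  (homogeneousSubmodule σ K n).map
    ((LinearMap.toSpanSingleton (MvPolynomial σ K) _ a).restrictScalars K)

theorem mem_multiples_of_eq_smul {a b : ι → MvPolynomial σ K} {w : MvPolynomial σ K} {k n : ℕ}
    (ha : ∀ i, (a i).IsHomogeneous k) (ha0 : a ≠ 0) (hb : ∀ i, (b i).IsHomogeneous (n + k))
    (h : b = w • a) : b ∈ multiples a n := by
  subst h
  obtain ⟨i, hi⟩ := Function.ne_iff.mp ha0
  exact ⟨w, isHomogeneous_of_mul_right (ha i) hi (hb i), rfl⟩

theorem finrank_multiples {a : ι → MvPolynomial (Fin 3) K} (ha : a ≠ 0) {c : ℚ} {m n : ℕ}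
    (h : (n : ℚ) = m + c) :
    (Module.finrank K (multiples a n) : ℚ) = (twistPoly c).eval (m : ℚ) := by
  rw [eval_twistPoly h, ← finrank_homogeneousSubmodule_fin_three K n, multiples,
    ← (Submodule.equivMapOfInjective _ (smul_left_injective (MvPolynomial (Fin 3) K) ha)
      _).finrank_eq]

theorem IsPrimitive.disjoint_multiples {a b : ι → MvPolynomial σ K} (ha : IsPrimitive a)
    (ha0 : a ≠ 0) (h : ∀ w : MvPolynomial σ K, b ≠ w • a) (g : MvPolynomial σ K) (m n : ℕ) :
    Disjoint (multiples (g • a) m) (multiples b n) := by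
  rw [Submodule.disjoint_def]
  rintro _ ⟨u, -, rfl⟩ ⟨v, -, huv⟩
  have huv (j : ι) : v * b j = u * (g * a j) := congrFun huv j
  obtain ⟨i, hi⟩ := Function.ne_iff.mp ha0
  rcases eq_or_ne v 0 with rfl | hv
  · exact funext fun j => (huv j).symm.trans (zero_mul (b j))
  · obtain ⟨w, hw⟩ := ha.exists_eq_smul_of_proportional hi (v := b) fun j k =>
      mul_left_cancel₀ hv (by rw [← mul_assoc, ← mul_assoc, huv, huv]; ring)
    exact absurd hw (h w)

end Multiples

section HilbertPolynomials

open MvPolynomial Filter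

variable {f : CoordRing} {d e k m n : ℕ} {F : Subsheaf (logTangentSheaf f)} {p q : Polynomial ℚ}
  {a b : Fin 3 → CoordRing}

theorem finite_formSections (hhom : f.IsHomogeneous d) (F : Subsheaf (logTangentSheaf f)) (m : ℕ) :
    Module.Finite ℂ (formSections F m) :=
  have := finite_syzygies (fun i => hhom.pderiv (i := i)) (m + 1)
  Submodule.finiteDimensional_of_le (formSections_le F m)

theorem isHilbertPolynomial_iff (hd : d ≠ 0) (hhom : f.IsHomogeneous d) (hf0 : f ≠ 0) :
    F.IsHilbertPolynomial q ↔
      ∀ᶠ m : ℕ in atTop, (Module.finrank ℂ (formSections F m) : ℚ) = q.eval (m : ℚ) := by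
  refine eventually_congr (Eventually.of_forall fun m => ?_)
  obtain ⟨φ⟩ := nonempty_formSections_equiv hd hhom hf0 F m
  have := finite_formSections hhom F m
  rw [← φ.finrank_eq, and_iff_right (Module.Finite.equiv φ)]

theorem Subsheaf.IsHilbertPolynomial.unique {E : P2.Modules} {F : Subsheaf E}
    (hp : F.IsHilbertPolynomial p) (hq : F.IsHilbertPolynomial q) : p = q :=
  eq_of_eventually_eval_eq <| by
    filter_upwards [hp, hq] with m hpm hqm
    rw [← hpm.2, ← hqm.2]

theorem exists_isHilbertPolynomial_whole (hd : d ≠ 0) (hhom : f.IsHomogeneous d)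
    (hred : Squarefree f) : ∃ p : Polynomial ℚ,
      (Subsheaf.whole (logTangentSheaf f)).IsHilbertPolynomial p ∧ p.natDegree ≤ 2 ∧
        rank p = 2 ∧ slope p = (3 - d) / 2 := by
  obtain ⟨t, ht⟩ := (isPrimitive_pderiv hd hhom hred).exists_finrank_syzygies_eq
    (e := d - 1) fun _ => hhom.pderiv
  let p := Polynomial.C 3 * twistPoly 1 - twistPoly d + Polynomial.C (t : ℚ)
  have hrank : rank p = 2 := by
    simp only [p, rank, Polynomial.coeff_add, Polynomial.coeff_sub, Polynomial.coeff_C_mul,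
      coeff_two_twistPoly, Polynomial.coeff_C_succ]
    norm_num
  refine ⟨p, (isHilbertPolynomial_iff hd hhom hred.ne_zero).mpr ?_, ?_, hrank, ?_⟩
  · filter_upwards [(tendsto_add_atTop_nat 1).eventually ht] with m hm
    rw [show m + 1 + (d - 1) = m + d by omega] at hm
    rw [formSections_whole]
    simp only [p, Polynomial.eval_add, Polynomial.eval_sub, Polynomial.eval_mul, Polynomial.eval_C,
      eval_twistPoly (Nat.cast_succ m), eval_twistPoly (Nat.cast_add m d)]
    rw [sub_add_eq_add_sub, eq_sub_iff_add_eq]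
    exact_mod_cast hm
  · exact Polynomial.natDegree_add_C.trans_le ((Polynomial.natDegree_sub_le _ _).trans (max_le
      ((Polynomial.natDegree_C_mul_le _ _).trans (natDegree_twistPoly_le 1))
      (natDegree_twistPoly_le d)))
  · rw [slope, degree, hrank]
    simp only [p, Polynomial.coeff_add, Polynomial.coeff_sub, Polynomial.coeff_C_mul,
      coeff_one_twistPoly, Polynomial.coeff_C_succ]
    ring

theorem natDegree_isHilbertPolynomial_le (hd : d ≠ 0) (hhom : f.IsHomogeneous d)
    (hred : Squarefree f) (hq : F.IsHilbertPolynomial q) : q.natDegree ≤ 2 := by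
  obtain ⟨p, hp, hp2, -⟩ := exists_isHilbertPolynomial_whole hd hhom hred
  rw [isHilbertPolynomial_iff hd hhom hred.ne_zero] at hp hq
  refine (natDegree_le_of_eventually (r := p) (hq.mono fun m hm => hm ▸ Nat.cast_nonneg _)
    ?_).trans hp2
  filter_upwards [hp, hq] with m hpm hqm
  rw [← hpm, ← hqm, Nat.cast_le]
  have := finite_formSections hhom (Subsheaf.whole (logTangentSheaf f)) m
  exact Submodule.finrank_mono ((formSections_le F m).trans_eq (formSections_whole f m).symm)

theorem exists_ne_zero_mem_formSections (hd : d ≠ 0) (hhom : f.IsHomogeneous d) (hf0 : f ≠ 0)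
    (hq : F.IsHilbertPolynomial q) (hq0 : q ≠ 0) : ∃ m, ∃ b ∈ formSections F m, b ≠ 0 := by
  by_contra! h
  refine hq0 (eq_of_eventually_eval_eq (((isHilbertPolynomial_iff hd hhom hf0).mp hq).mono
    fun m hm => ?_))
  rw [← hm, (Submodule.eq_bot_iff _).mpr (h m), finrank_bot, Polynomial.eval_zero, Nat.cast_zero]

theorem multiples_le_formSections (hb : b ∈ formSections F n) (hnm : n ≤ m) :
    multiples b (m - n) ≤ formSections F m := by
  rintro _ ⟨h, hh, rfl⟩
  exact Nat.add_sub_cancel' hnm ▸ smul_mem_formSections hb hh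

theorem one_le_rank (hd : d ≠ 0) (hhom : f.IsHomogeneous d) (hred : Squarefree f)
    (hq : F.IsHilbertPolynomial q) (hb : b ∈ formSections F n) (hb0 : b ≠ 0) : 1 ≤ rank q := by
  have hcoeff := coeff_le_of_eventually (n := 2) (q := twistPoly (-n)) (r := q)
    ((Polynomial.natDegree_sub_le _ _).trans (max_le
      (natDegree_isHilbertPolynomial_le hd hhom hred hq) (natDegree_twistPoly_le _))) <| by
    filter_upwards [(isHilbertPolynomial_iff hd hhom hred.ne_zero).mp hq, eventually_ge_atTop n]
      with m hm hnm
    have := finite_formSections hhom F m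
    rw [← hm, ← finrank_multiples hb0 (n := m - n) (by push_cast [hnm]; ring), Nat.cast_le]
    exact Submodule.finrank_mono (multiples_le_formSections hb hnm)
  rw [coeff_two_twistPoly] at hcoeff
  rw [rank]
  linarith

theorem two_le_rank (hd : d ≠ 0) (hhom : f.IsHomogeneous d) (hred : Squarefree f)
    (hq : F.IsHilbertPolynomial q) (ha : a ∈ formSections F k) (ha0 : a ≠ 0)
    (hb : b ∈ formSections F n) (hb0 : b ≠ 0)
    (hab : ∀ i j, Disjoint (multiples a i) (multiples b j)) : 2 ≤ rank q := by
  have hcoeff := coeff_le_of_eventually (n := 2) (q := twistPoly (-k) + twistPoly (-n)) (r := q)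
    ((Polynomial.natDegree_sub_le _ _).trans (max_le
      (natDegree_isHilbertPolynomial_le hd hhom hred hq)
      (Polynomial.natDegree_add_le_of_degree_le (natDegree_twistPoly_le _)
        (natDegree_twistPoly_le _)))) <| by
    filter_upwards [(isHilbertPolynomial_iff hd hhom hred.ne_zero).mp hq, eventually_ge_atTop k,
      eventually_ge_atTop n] with m hm hkm hnm
    have := finite_formSections hhom F m
    rw [Polynomial.eval_add, ← hm, ← finrank_multiples ha0 (n := m - k) (by push_cast [hkm]; ring),
      ← finrank_multiples hb0 (n := m - n) (by push_cast [hnm]; ring), ← Nat.cast_add,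
      Nat.cast_le]
    have hak := multiples_le_formSections ha hkm
    have hbn := multiples_le_formSections hb hnm
    have := Submodule.finiteDimensional_of_le hak
    have := Submodule.finiteDimensional_of_le hbn
    rw [← Submodule.finrank_sup_add_finrank_inf_eq, (hab _ _).eq_bot, finrank_bot, add_zero]
    exact Submodule.finrank_mono (sup_le hak hbn)
  rw [Polynomial.coeff_add, coeff_two_twistPoly, coeff_two_twistPoly] at hcoeff
  rw [rank]
  linarith

theorem slope_le_of_forall_eq_smul (hd : d ≠ 0) (hhom : f.IsHomogeneous d) (hred : Squarefree f)
    (hq : F.IsHilbertPolynomial q) (hrank : 1 ≤ rank q) (ha : ∀ i, (a i).IsHomogeneous k)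
    (ha0 : a ≠ 0) (h : ∀ m, ∀ b ∈ formSections F m, ∃ w : CoordRing, b = w • a) :
    slope q ≤ 1 - k := by
  have hle : ∀ᶠ m : ℕ in atTop, q.eval (m : ℚ) ≤ (twistPoly (1 - k)).eval (m : ℚ) := by
    filter_upwards [(isHilbertPolynomial_iff hd hhom hred.ne_zero).mp hq, eventually_ge_atTop k]
      with m hm hkm
    have hkm : k ≤ m + 1 := hkm.trans m.le_succ
    rw [← hm, ← finrank_multiples ha0 (n := m + 1 - k) (by push_cast [hkm]; ring), Nat.cast_le]
    have : Module.Finite ℂ (multiples a (m + 1 - k)) := Module.Finite.map _ _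
    refine Submodule.finrank_mono fun b hb => ?_
    obtain ⟨w, hw⟩ := h m b hb
    refine mem_multiples_of_eq_smul ha ha0 (fun i => ?_) hw
    rw [Nat.sub_add_cancel hkm]
    exact (formSections_le F m hb).1 i
  have hdeg2 : (twistPoly (1 - k) - q).natDegree ≤ 2 :=
    (Polynomial.natDegree_sub_le _ _).trans (max_le (natDegree_twistPoly_le _)
      (natDegree_isHilbertPolynomial_le hd hhom hred hq))
  have hcoeff2 : q.coeff 2 = 1 / 2 := by
    have := coeff_le_of_eventually hdeg2 hle
    rw [coeff_two_twistPoly] at this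
    rw [rank] at hrank
    linarith
  have hdeg1 : (twistPoly (1 - k) - q).natDegree ≤ 1 :=
    Polynomial.natDegree_le_iff_coeff_eq_zero.mpr fun N hN => by
      rcases (Nat.succ_le_of_lt hN).eq_or_lt with rfl | hN
      · rw [Polynomial.coeff_sub, coeff_two_twistPoly, hcoeff2, sub_self]
      · exact Polynomial.coeff_eq_zero_of_natDegree_lt (hdeg2.trans_lt hN)
  have hcoeff1 := coeff_le_of_eventually hdeg1 hle
  rw [coeff_one_twistPoly] at hcoeff1
  rw [slope, degree, rank, hcoeff2]
  linarith

theorem hasSyzygy_of_le (hke : k ≤ e) (ha : a ∈ jacobianSyzygies f k) (ha0 : a ≠ 0) :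
    HasSyzygy f e := by
  obtain ⟨hhom, hsum⟩ := smul_mem_jacobianSyzygies ha (isHomogeneous_X_pow 0 (e - k))
  rw [Nat.add_sub_cancel' hke] at hhom
  exact ⟨_, hhom, smul_ne_zero (pow_ne_zero _ (X_ne_zero 0)) ha0, hsum⟩

theorem slope_lt_of_not_hasSyzygy (hd : d ≠ 0) (hhom : f.IsHomogeneous d) (hred : Squarefree f)
    (hde : d ≤ 2 * e + 2) (he : ¬ HasSyzygy f e) (hq : F.IsHilbertPolynomial q) (hq0 : 0 < rank q)
    (hq2 : rank q < 2) : slope q < (3 - d) / 2 := by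
  obtain ⟨n, b, hb, hb0⟩ := exists_ne_zero_mem_formSections hd hhom hred.ne_zero hq <| by
    rintro rfl
    rw [rank, Polynomial.coeff_zero, mul_zero] at hq0
    exact hq0.false
  obtain ⟨k, -, g, a, rfl, ha0, hprim, ha⟩ :=
    exists_isPrimitive_mem_syzygies (formSections_le F n hb) hb0
  have hek : e < k := by
    by_contra! hke
    exact he (hasSyzygy_of_le hke ha ha0)
  have hmul : ∀ m, ∀ c ∈ formSections F m, ∃ w : CoordRing, c = w • a := by
    by_contra! h
    obtain ⟨m, c, hc, hne⟩ := h
    have hc0 : c ≠ 0 := fun h0 => hne 0 (by rw [h0, zero_smul])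
    exact hq2.not_ge (two_le_rank hd hhom hred hq hb hb0 hc hc0
      (hprim.disjoint_multiples ha0 hne g))
  have hslope := slope_le_of_forall_eq_smul hd hhom hred hq
    (one_le_rank hd hhom hred hq hb hb0) ha.1 ha0 hmul
  have hek' : (e : ℚ) + 1 ≤ k := by exact_mod_cast hek
  have hde' : (d : ℚ) ≤ 2 * e + 2 := by exact_mod_cast hde
  linarith

theorem isStable_of_not_hasSyzygy (hd : d ≠ 0) (hhom : f.IsHomogeneous d) (hred : Squarefree f)
    (hde : d ≤ 2 * e + 2) (he : ¬ HasSyzygy f e) : IsStable (logTangentSheaf f) := by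
  obtain ⟨p, hp, -, hrank, hslope⟩ := exists_isHilbertPolynomial_whole hd hhom hred
  refine ⟨p, hp, fun F _ q hq hq0 hqp => ?_⟩
  rw [hslope]
  exact slope_lt_of_not_hasSyzygy hd hhom hred hde he hq hq0 (hrank ▸ hqp)

end HilbertPolynomials

/-! ### Subsheaves generated by a primitive syzygy -/

section MultipleSheaves

open MvPolynomial Filter

variable {f : CoordRing} {d e k m n : ℕ} {a b : Fin 3 → CoordRing} {U V W : P2.Opens} {i : Fin 3}
  {D E : Γ(logTangentSheaf f, U)}

/-- The field `D` is on `W` the multiple of `∑ aⱼ ∂ⱼ` by a fraction of degree `1 - k`, as it should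
be when the entries of `a` have degree `k`. -/
def IsFractionOn (D : Γ(logTangentSheaf f, U)) (a : Fin 3 → CoordRing) (k : ℕ) (W : P2.Opens) :
    Prop :=
  ∃ (n n' : ℕ) (p q : CoordRing), n + k = n' + 1 ∧ p.IsHomogeneous n ∧ q.IsHomogeneous n' ∧
    ∀ y ∈ W, ∀ hy : y ∈ U, q ∉ pointIdeal y ∧ ∀ s, germToFrac y (fieldAt D y hy s) =
      toFrac p / toFrac q * rationalField ℂ FracField (toFrac ∘ a) (germToFrac y s)

theorem isFractionOn_zero (a : Fin 3 → CoordRing) (k : ℕ) (i : Fin 3) :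
    IsFractionOn (0 : Γ(logTangentSheaf f, U)) a k (chart i) := by
  refine ⟨1, k, 0, X i ^ k, add_comm 1 k, isHomogeneous_zero _ _ _, isHomogeneous_X_pow i k,
    fun y hyi hy => ⟨X_pow_notMem hyi k, fun s => ?_⟩⟩
  rw [map_zero, zero_div, zero_mul]
  exact map_zero (germToFrac y)

theorem IsFractionOn.add (hD : IsFractionOn D a k V) (hE : IsFractionOn E a k W) :
    IsFractionOn (D + E) a k (V ⊓ W) := by
  obtain ⟨n₁, n₁', p₁, q₁, h₁, hp₁, hq₁, hD⟩ := hD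
  obtain ⟨n₂, n₂', p₂, q₂, h₂, hp₂, hq₂, hE⟩ := hE
  refine ⟨n₁ + n₂', n₁' + n₂', p₁ * q₂ + p₂ * q₁, q₁ * q₂, by omega, (hp₁.mul hq₂).add ?_,
    hq₁.mul hq₂, fun y hyW hy => ?_⟩
  · rw [show n₁ + n₂' = n₂ + n₁' by omega]
    exact hp₂.mul hq₁
  · obtain ⟨hy₁, hD⟩ := hD y hyW.1 hy
    obtain ⟨hy₂, hE⟩ := hE y hyW.2 hy
    refine ⟨mul_notMem hy₁ hy₂, fun s => ?_⟩
    have h1 := toFrac_ne_zero (ne_zero_of_notMem hy₁)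
    have h2 := toFrac_ne_zero (ne_zero_of_notMem hy₂)
    rw [fieldAt_add, Derivation.add_apply, map_add, hD, hE, map_add, map_mul, map_mul, map_mul]
    field_simp

theorem IsFractionOn.smul (hD : IsFractionOn D a k V) (r : Γ(P2, U)) {x : P2} (hxU : x ∈ U)
    (hxV : x ∈ V) : ∃ W : P2.Opens, x ∈ W ∧ IsFractionOn (r • D) a k W := by
  obtain ⟨n, n', p, q, h, hp, hq, hD⟩ := hD
  obtain ⟨W, -, l, b, c, hx, hb, hc, hr⟩ := exists_local_fraction r hxU
  refine ⟨V ⊓ W, ⟨hxV, hx⟩, l + n, l + n', b * p, c * q, by omega, hb.mul hp, hc.mul hq,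
    fun y hyW hy => ?_⟩
  obtain ⟨hqy, hD⟩ := hD y hyW.1 hy
  obtain ⟨hcy, hr⟩ := hr y hyW.2 hy
  refine ⟨mul_notMem hcy hqy, fun s => ?_⟩
  rw [fieldAt_smul, Derivation.smul_apply, smul_eq_mul, map_mul (germToFrac y), hr, hD, map_mul,
    map_mul, ← mul_assoc, div_mul_div_comm]

/-- The subsheaf of the logarithmic vector fields that are multiples of `∑ aⱼ ∂ⱼ`, where the
entries of `a` are thought of as forms of degree `k`. -/
def multipleSheaf (f : CoordRing) (a : Fin 3 → CoordRing) (k : ℕ) :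
    Subsheaf (logTangentSheaf f) where
  sections U :=
    { carrier := {D | ∀ x ∈ U, ∃ V : P2.Opens, x ∈ V ∧ IsFractionOn D a k V}
      zero_mem' := fun x _ => by
        obtain ⟨i, hi⟩ := exists_mem_chart x
        exact ⟨chart i, hi, isFractionOn_zero a k i⟩
      add_mem' := fun hD hE x hx => by
        obtain ⟨V, hV, hDV⟩ := hD x hx
        obtain ⟨W, hW, hEW⟩ := hE x hx
        exact ⟨V ⊓ W, ⟨hV, hW⟩, hDV.add hEW⟩
      smul_mem' := fun r D hD x hx => by
        obtain ⟨V, hV, hDV⟩ := hD x hx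
        exact hDV.smul r hx hV }
  res_mem {U V} h D hD x hx := by
    obtain ⟨W, hW, n, n', p, q, hn, hp, hq, hD⟩ := hD x (h hx)
    exact ⟨W, hW, n, n', p, q, hn, hp, hq, fun y hy hyV => hD y hy (h hyV)⟩
  locality U D hD x hx := by
    obtain ⟨V, h, hxV, hDV⟩ := hD x hx
    obtain ⟨W, hW, n, n', p, q, hn, hp, hq, hD⟩ := hDV x hxV
    exact ⟨V ⊓ W, ⟨hxV, hW⟩, n, n', p, q, hn, hp, hq, fun y hy _ => hD y hy.2 hy.1⟩

theorem isFractionOn_chartField {h : CoordRing} (hh : h.IsHomogeneous n)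
    (hha : h • a ∈ jacobianSyzygies f (m + 1)) (hnk : n + k = m + 1) (i : Fin 3) :
    IsFractionOn (chartField hha i) a k (chart i) := by
  refine ⟨n, m, h, X i ^ m, hnk, hh, isHomogeneous_X_pow i m,
    fun y _ hy => ⟨X_pow_notMem hy m, fun s => ?_⟩⟩
  rw [fieldAt_chartField, germToFrac_germDer, map_smul, chartDer_apply,
    ← algebraMap_smul FracField h, smul_smul, map_pow, div_eq_mul_inv]
  rfl

theorem chartField_mem_multipleSheaf {h : CoordRing} (hh : h.IsHomogeneous n)
    (hha : h • a ∈ jacobianSyzygies f (m + 1)) (hnk : n + k = m + 1) (i : Fin 3) :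
    chartField hha i ∈ (multipleSheaf f a k).sections (chart i) := fun _ hx =>
  ⟨chart i, hx, isFractionOn_chartField hh hha hnk i⟩

theorem exists_res_eq_smul_chartField (hV : V ≤ chart i) {t : Γ(logTangentSheaf f, V)}
    (ht : IsFractionOn t a k W) (hXa : (X i : CoordRing) • a ∈ jacobianSyzygies f (k + 1)) :
    ∃ r : Γ(P2, V ⊓ W), res (logTangentSheaf f) (inf_le_left : V ⊓ W ≤ V) t =
      r • res (logTangentSheaf f) ((inf_le_left : V ⊓ W ≤ V).trans hV) (chartField hXa i) := by
  obtain ⟨n, n', p, q, h, hp, hq, H⟩ := ht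
  obtain ⟨r, hr⟩ := exists_section_of_fraction (U := V ⊓ W) (hp.mul (isHomogeneous_X_pow i k))
    (h ▸ hq.mul (isHomogeneous_X ℂ i)) fun z hz => mul_notMem (H z hz.2 hz.1).1 (hV hz.1)
  refine ⟨r, fieldAt_ext fun z hz => Derivation.ext fun s => germToFrac_injective z ?_⟩
  have hq0 := toFrac_ne_zero (ne_zero_of_notMem (H z hz.2 hz.1).1)
  have hX0 := toFrac_X_ne_zero i
  rw [fieldAt_smul, Derivation.smul_apply, smul_eq_mul, map_mul (germToFrac z), fieldAt_res,
    fieldAt_res, (H z hz.2 hz.1).2, hr, fieldAt_chartField, germToFrac_germDer, map_smul,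
    chartDer_apply, ← algebraMap_smul FracField (X i : CoordRing), smul_smul,
    Derivation.smul_apply, smul_eq_mul]
  simp only [map_mul, map_pow]
  field_simp

theorem multipleSheaf_isCoherent (ha : a ∈ jacobianSyzygies f k) :
    (multipleSheaf f a k).IsCoherent := by
  intro x
  obtain ⟨i, hi⟩ := exists_mem_chart x
  have hXa := smul_mem_jacobianSyzygies ha (isHomogeneous_X ℂ i)
  refine ⟨chart i, hi, 1, fun _ => chartField hXa i, fun _ =>
    chartField_mem_multipleSheaf (isHomogeneous_X ℂ i) hXa (add_comm 1 k) i,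
    fun V hV t ht y hy => ?_⟩
  obtain ⟨W, hyW, htW⟩ := ht y hy
  obtain ⟨r, hr⟩ := exists_res_eq_smul_chartField hV htW hXa
  refine ⟨V ⊓ W, inf_le_left, ⟨hy, hyW⟩, ?_⟩
  rw [hr]
  exact Submodule.smul_mem _ _ (Submodule.subset_span ⟨0, rfl⟩)

theorem exists_smul_eq_smul_of_isFractionOn (hd : d ≠ 0) (hhom : f.IsHomogeneous d) (hf0 : f ≠ 0)
    (ha : a ∈ jacobianSyzygies f k) (hb : b ∈ jacobianSyzygies f (m + 1))
    (hW : genericPoint ∈ W) (h : IsFractionOn (chartField hb i) a k W) :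
    ∃ p q : CoordRing, q ≠ 0 ∧ q • b = p • a := by
  obtain ⟨n, n', p, q, -, -, -, H⟩ := h
  obtain ⟨hq, H⟩ := H genericPoint hW (genericPoint_mem_chart i)
  have hq0 := ne_zero_of_notMem hq
  refine ⟨p * X i ^ m, q, hq0, sub_eq_zero.mp
    (eq_zero_of_proportional_X (i := i) hd hhom hf0 ?_ fun j => toFrac_injective ?_)⟩
  · simp only [Pi.sub_apply, Pi.smul_apply, smul_eq_mul, sub_mul, Finset.sum_sub_distrib,
      mul_assoc, ← Finset.mul_sum]
    rw [show ∑ j, b j * pderiv j f = 0 from hb.2, show ∑ j, a j * pderiv j f = 0 from ha.2]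
    simp only [mul_zero, sub_zero]
  · have hb' := chartDer_ratio i j m b
    have ha' := chartDer_ratio i j 0 a
    have hratio := H (sectionAt (ratio i j) genericPoint (genericPoint_mem_chart i))
    rw [fieldAt_chartField, germToFrac_germDer, germToFrac_ratio] at hratio
    rw [chartDer_apply, pow_zero, inv_one, one_smul] at ha'
    have hX0 := toFrac_X_ne_zero i
    have hq1 := toFrac_ne_zero hq0
    rw [hratio] at hb'
    field_simp at hb'
    simp only [Pi.sub_apply, Pi.smul_apply, smul_eq_mul, map_sub, map_mul, map_pow] at ha' hb' ⊢
    linear_combination toFrac p * toFrac (X i) ^ m * ha' - hb'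

theorem formSections_multipleSheaf (hd : d ≠ 0) (hhom : f.IsHomogeneous d) (hf0 : f ≠ 0)
    (ha : a ∈ jacobianSyzygies f k) (hprim : IsPrimitive a) (ha0 : a ≠ 0) (hkm : k ≤ m + 1) :
    formSections (multipleSheaf f a k) m = multiples a (m + 1 - k) := by
  have hdeg : m + 1 - k + k = m + 1 := Nat.sub_add_cancel hkm
  refine le_antisymm (fun b hb => ?_) ?_
  · obtain ⟨hb, hmem⟩ := mem_formSections.mp hb
    obtain ⟨W, hW, hbW⟩ := hmem 0 genericPoint (genericPoint_mem_chart 0)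
    obtain ⟨p, q, hq0, hqb⟩ := exists_smul_eq_smul_of_isFractionOn hd hhom hf0 ha hb hW hbW
    have hqb (j : Fin 3) : q * b j = p * a j := congrFun hqb j
    obtain ⟨i, hi⟩ := Function.ne_iff.mp ha0
    obtain ⟨w, hw⟩ := hprim.exists_eq_smul_of_proportional hi (v := b) fun j l =>
      mul_left_cancel₀ hq0 (by rw [← mul_assoc, ← mul_assoc, hqb, hqb]; ring)
    exact mem_multiples_of_eq_smul ha.1 ha0 (fun j => hdeg.symm ▸ hb.1 j) hw
  · rintro _ ⟨h, hh, rfl⟩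
    have hha : h • a ∈ jacobianSyzygies f (m + 1) :=
      (add_comm k _).trans hdeg ▸ smul_mem_jacobianSyzygies ha hh
    exact mem_formSections.mpr ⟨hha, chartField_mem_multipleSheaf hh hha hdeg⟩

theorem isHilbertPolynomial_multipleSheaf (hd : d ≠ 0) (hhom : f.IsHomogeneous d) (hf0 : f ≠ 0)
    (ha : a ∈ jacobianSyzygies f k) (hprim : IsPrimitive a) (ha0 : a ≠ 0) :
    (multipleSheaf f a k).IsHilbertPolynomial (twistPoly (1 - k)) := by
  rw [isHilbertPolynomial_iff hd hhom hf0]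
  filter_upwards [eventually_ge_atTop k] with m hkm
  have hkm : k ≤ m + 1 := hkm.trans m.le_succ
  rw [formSections_multipleSheaf hd hhom hf0 ha hprim ha0 hkm,
    finrank_multiples ha0 (c := 1 - k) (by push_cast [hkm]; ring)]

theorem not_isStable_of_hasSyzygy (hd : d ≠ 0) (hhom : f.IsHomogeneous d) (hred : Squarefree f)
    (hde : 2 * e + 1 ≤ d) (he : HasSyzygy f e) : ¬ IsStable (logTangentSheaf f) := by
  rintro ⟨p, hp, hstable⟩
  obtain ⟨b, hbhom, hb0, hb⟩ := he
  obtain ⟨k, hke, g, a, -, ha0, hprim, ha⟩ := exists_isPrimitive_mem_syzygies ⟨hbhom, hb⟩ hb0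
  obtain ⟨p', hp', -, hrank, hslope⟩ := exists_isHilbertPolynomial_whole hd hhom hred
  obtain rfl : p = p' := hp.unique hp'
  have hlt := hstable _ (multipleSheaf_isCoherent ha) _
    (isHilbertPolynomial_multipleSheaf hd hhom hred.ne_zero ha hprim ha0)
    (by rw [rank_twistPoly]; exact one_pos) (by rw [rank_twistPoly, hrank]; exact one_lt_two)
  rw [slope_twistPoly, hslope] at hlt
  have hke' : (k : ℚ) ≤ e := by exact_mod_cast hke
  have hde' : 2 * (e : ℚ) + 1 ≤ d := by exact_mod_cast hde
  linarith

end MultipleSheaves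

end PlaneCurve

end

theorem proposition2p4_general {d : ℕ} (hd : d ≠ 0) {f : PlaneCurve.CoordRing}
    (hhom : f.IsHomogeneous d) (hred : Squarefree f) :
    (PlaneCurve.IsStable (PlaneCurve.logTangentSheaf f) ↔
      ¬ PlaneCurve.HasSyzygy f ((d - 1) / 2)) ∧
    (d ≠ 1 → PlaneCurve.IsNonsingular f →
      PlaneCurve.IsStable (PlaneCurve.logTangentSheaf f)) := by
  have hstable (he : ¬ PlaneCurve.HasSyzygy f ((d - 1) / 2)) :=
    PlaneCurve.isStable_of_not_hasSyzygy hd hhom hred (by omega) he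
  exact ⟨⟨fun hs he => PlaneCurve.not_isStable_of_hasSyzygy hd hhom hred (by omega) he hs,
    hstable⟩,
    fun hd1 hns => hstable (PlaneCurve.not_hasSyzygy_of_isNonsingular (by omega) hhom hns)⟩

theorem proposition2p4 (d : ℕ) (hd : 4 ≤ d) (f : PlaneCurve.CoordRing)
    (hhom : f.IsHomogeneous d) (hred : Squarefree f) :
    (PlaneCurve.IsStable (PlaneCurve.logTangentSheaf f) ↔
      ¬ PlaneCurve.HasSyzygy f ((d - 1) / 2)) ∧
    (PlaneCurve.IsNonsingular f → PlaneCurve.IsStable (PlaneCurve.logTangentSheaf f)) := by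
  obtain ⟨hiff, hnonsing⟩ := proposition2p4_general (by omega : d ≠ 0) hhom hred
  exact ⟨hiff, hnonsing (by omega)⟩
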